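/- Let $n\ge 2$, and let $l_1,\dots,l_{n+1}$ be linear forms on $\mathbf C^n$ such that any $n$ of them are linearly independent (a generic family). Let $A_n(\mathbf C)[s_1,\dots,s_{n+1}]$ be the Weyl algebra of differential operators with coefficients in $\mathbf C[x_1,\dots,x_n]$, with central variables $s_1,\dots,s_{n+1}$ adjoined. It acts on the free rank-one module $\mathbf C[x,s,\tfrac1{l_1\cdots l_{n+1}}]\; l_1^{s_1}\cdots l_{n+1}^{s_{n+1}}$ in the natural way: the $x_i$ and the $s_j$ act by multiplication, and $$\partial_{x_i}\bigl(g\, l_1^{s_1}\cdots l_{n+1}^{s_{n+1}}\bigr)=\Bigl(\partial_{x_i}g+g\sum_{j=1}^{n+1}s_j\,\frac{\partial_{x_i} l_j}{l_j}\Bigr)\, l_1^{s_1}\cdots l_{n+1}^{s_{n+1}} .$$ Put $l_1^{s_1+1}\cdots l_{n+1}^{s_{n+1}+1}=l_1\cdots l_{n+1}\; l_1^{s_1}\cdots l_{n+1}^{s_{n+1}}$. The Bernstein ideal of $(l_1,\dots,l_{n+1})$ is the ideal $\mathcal B(l_1,\dots,l_{n+1})$ of all $b\in\mathbf C[s_1,\dots,s_{n+1}]$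 such that $$b(s_1,\dots,s_{n+1})\; l_1^{s_1}\cdots l_{n+1}^{s_{n+1}}\in A_n(\mathbf C)[s_1,\dots,s_{n+1}]\; l_1^{s_1+1}\cdots l_{n+1}^{s_{n+1}+1}.$$ Then $\mathcal B(l_1,\dots,l_{n+1})$ is principal, generated by $$\prod_{j=1}^{n+1}(s_j+1)\;\prod_{k=0}^{n}\bigl(s_1+\cdots+s_{n+1}+n+k\bigr).$$ -/

import Mathlib

open MvPolynomial

noncomputable section

/-! ### The Weyl algebra over a commutative ring of parameters -/

/-- The generators of the Weyl algebra in `n` variables. -/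
inductive WeylGen (n : ℕ) : Type
  | x (i : Fin n) : WeylGen n
  | d (i : Fin n) : WeylGen n

/-- The relations of the Weyl algebra: `[xᵢ, xⱼ] = 0`, `[∂ᵢ, ∂ⱼ] = 0`, `[∂ᵢ, xⱼ] = δᵢⱼ`. -/
inductive WeylRel (R : Type) [CommRing R] (n : ℕ) :
    FreeAlgebra R (WeylGen n) → FreeAlgebra R (WeylGen n) → Prop
  | x_comm (i j : Fin n) : WeylRel R n
      (FreeAlgebra.ι R (WeylGen.x i) * FreeAlgebra.ι R (WeylGen.x j))
      (FreeAlgebra.ι R (WeylGen.x j) * FreeAlgebra.ι R (WeylGen.x i))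
  | d_comm (i j : Fin n) : WeylRel R n
      (FreeAlgebra.ι R (WeylGen.d i) * FreeAlgebra.ι R (WeylGen.d j))
      (FreeAlgebra.ι R (WeylGen.d j) * FreeAlgebra.ι R (WeylGen.d i))
  | d_x (i j : Fin n) : WeylRel R n
      (FreeAlgebra.ι R (WeylGen.d i) * FreeAlgebra.ι R (WeylGen.x j))
      (FreeAlgebra.ι R (WeylGen.x j) * FreeAlgebra.ι R (WeylGen.d i) + if i = j then 1 else 0)

/-- The `n`-th Weyl algebra over `R`, i.e. the `R`-algebra generated by `x₁, …, xₙ, ∂₁, …, ∂ₙ`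
with the usual commutation relations (the elements of `R` being central). For
`R = ℂ[s₁, …, s_p]` this is `A_n(ℂ)[s₁, …, s_p]`. -/
abbrev WeylAlgebra (R : Type) [CommRing R] (n : ℕ) : Type := RingQuot (WeylRel R n)

namespace WeylAlgebra

variable (R : Type) [CommRing R] (n : ℕ)

/-- The generator `xᵢ` of the Weyl algebra. -/
def x (i : Fin n) : WeylAlgebra R n :=
  RingQuot.mkAlgHom R (WeylRel R n) (FreeAlgebra.ι R (WeylGen.x i))

/-- The generator `∂ᵢ` of the Weyl algebra. -/
def d (i : Fin n) : WeylAlgebra R n :=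
  RingQuot.mkAlgHom R (WeylRel R n) (FreeAlgebra.ι R (WeylGen.d i))

variable {R n}

/-- The representation of the Weyl algebra on an `R`-module `M` determined by endomorphisms
`a i`, `b i` that satisfy the relations. -/
def lift {M : Type} [AddCommGroup M] [Module R M] (a b : Fin n → Module.End R M)
    (haa : ∀ i j, a i * a j = a j * a i) (hbb : ∀ i j, b i * b j = b j * b i)
    (hba : ∀ i j, b i * a j = a j * b i + if i = j then 1 else 0) :
    WeylAlgebra R n →ₐ[R] Module.End R M :=
  RingQuot.liftAlgHom R
    ⟨FreeAlgebra.lift R (fun g : WeylGen n => match g with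
      | WeylGen.x i => a i
      | WeylGen.d i => b i), by
      intro u v h
      induction h with
      | x_comm i j => simpa using haa i j
      | d_comm i j => simpa using hbb i j
      | d_x i j =>
        have h := hba i j
        by_cases hij : i = j
        · subst hij
          simpa using h
        · simpa [hij] using h⟩

variable {M : Type} [AddCommGroup M] [Module R M] (a b : Fin n → Module.End R M)
    (haa : ∀ i j, a i * a j = a j * a i) (hbb : ∀ i j, b i * b j = b j * b i)
    (hba : ∀ i j, b i * a j = a j * b i + if i = j then 1 else 0)

theorem lift_x (i : Fin n) : lift a b haa hbb hba (x R n i) = a i := by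
  simp [lift, x]

theorem lift_d (i : Fin n) : lift a b haa hbb hba (d R n i) = b i := by
  simp [lift, d]

end WeylAlgebra

/-! ### Extension of a derivation to a localization -/

section LocalizedDerivation

variable {R A : Type} [CommRing R] [CommRing A] [Algebra R A] (D : Derivation R A A) (F : A)

/-- The ring homomorphism `a ↦ a + ε D a` to the dual numbers over `A[1/F]`. -/
def dualNumberHom : A →+* DualNumber (Localization.Away F) where
  toFun a := TrivSqZeroExt.inl (algebraMap A _ a) + TrivSqZeroExt.inr (algebraMap A _ (D a))
  map_one' := by ext <;> simp
  map_zero' := by ext <;> simp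
  map_add' a b := by
    ext <;> simp only [TrivSqZeroExt.fst_add, TrivSqZeroExt.snd_add, TrivSqZeroExt.fst_inl,
      TrivSqZeroExt.snd_inl, TrivSqZeroExt.fst_inr, TrivSqZeroExt.snd_inr, map_add] <;> ring
  map_mul' a b := by
    ext <;> simp only [TrivSqZeroExt.fst_add, TrivSqZeroExt.snd_add, TrivSqZeroExt.fst_inl,
      TrivSqZeroExt.snd_inl, TrivSqZeroExt.fst_inr, TrivSqZeroExt.snd_inr, map_add, map_mul,
      TrivSqZeroExt.fst_mul, TrivSqZeroExt.snd_mul, Derivation.leibniz, smul_eq_mul,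
      MulOpposite.smul_eq_mul_unop, MulOpposite.unop_op] <;> ring

theorem fst_dualNumberHom (a : A) : (dualNumberHom D F a).fst = algebraMap A _ a := by
  change TrivSqZeroExt.fst (TrivSqZeroExt.inl (algebraMap A (Localization.Away F) a) +
    TrivSqZeroExt.inr (algebraMap A (Localization.Away F) (D a))) = _
  rw [TrivSqZeroExt.fst_add, TrivSqZeroExt.fst_inl, TrivSqZeroExt.fst_inr, add_zero]

theorem snd_dualNumberHom (a : A) : (dualNumberHom D F a).snd = algebraMap A _ (D a) := by
  change TrivSqZeroExt.snd (TrivSqZeroExt.inl (algebraMap A (Localization.Away F) a) +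
    TrivSqZeroExt.inr (algebraMap A (Localization.Away F) (D a))) = _
  rw [TrivSqZeroExt.snd_add, TrivSqZeroExt.snd_inl, TrivSqZeroExt.snd_inr, zero_add]

theorem isUnit_dualNumberHom : IsUnit (dualNumberHom D F F) := by
  rw [TrivSqZeroExt.isUnit_iff_isUnit_fst, fst_dualNumberHom]
  exact IsLocalization.Away.algebraMap_isUnit (S := Localization.Away F) F

/-- The extension of `dualNumberHom` to `A[1/F]`. -/
def dualNumberLift : Localization.Away F →+* DualNumber (Localization.Away F) :=
  IsLocalization.Away.lift F (isUnit_dualNumberHom D F)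

theorem dualNumberLift_algebraMap (a : A) :
    dualNumberLift D F (algebraMap A _ a) = dualNumberHom D F a :=
  IsLocalization.Away.lift_eq F (isUnit_dualNumberHom D F) a

theorem fst_dualNumberLift (g : Localization.Away F) :
    (dualNumberLift D F g).fst = g := by
  have h : ((TrivSqZeroExt.fstHom (Localization.Away F) (Localization.Away F)
      (Localization.Away F)).toRingHom.comp (dualNumberLift D F)) = RingHom.id _ := by
    apply IsLocalization.ringHom_ext (Submonoid.powers F)
    ext a
    change (dualNumberLift D F (algebraMap A _ a)).fst = algebraMap A _ a
    rw [dualNumberLift_algebraMap, fst_dualNumberHom]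
  exact congrArg (fun φ : Localization.Away F →+* Localization.Away F => φ g) h

/-- The unique extension of the derivation `D` of `A` to `A[1/F]`. -/
def localizedDerivation : Derivation R (Localization.Away F) (Localization.Away F) :=
  Derivation.mk'
    { toFun := fun g => (dualNumberLift D F g).snd
      map_add' := fun g h => by simp
      map_smul' := fun r g => by
        have h : dualNumberLift D F (algebraMap R _ r) = TrivSqZeroExt.inl (algebraMap R _ r) := by
          rw [IsScalarTower.algebraMap_apply R A (Localization.Away F),
            dualNumberLift_algebraMap]
          apply TrivSqZeroExt.ext
          · rw [fst_dualNumberHom, TrivSqZeroExt.fst_inl]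
          · rw [snd_dualNumberHom, TrivSqZeroExt.snd_inl, Derivation.map_algebraMap, map_zero]
        rw [Algebra.smul_def, map_mul, h]
        simp [Algebra.smul_def] }
    (fun g h => by simp [fst_dualNumberLift, mul_comm])

theorem localizedDerivation_algebraMap (a : A) :
    localizedDerivation D F (algebraMap A _ a) = algebraMap A _ (D a) := by
  change (dualNumberLift D F (algebraMap A _ a)).snd = _
  rw [dualNumberLift_algebraMap, snd_dualNumberHom]

theorem localizedDerivation_comm (D' : Derivation R A A) (h : ∀ a, D (D' a) = D' (D a))
    (g : Localization.Away F) :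
    localizedDerivation D F (localizedDerivation D' F g) =
      localizedDerivation D' F (localizedDerivation D F g) := by
  obtain ⟨⟨a, s⟩, hs⟩ := IsLocalization.surj (Submonoid.powers F) g
  have hu : IsUnit (algebraMap A (Localization.Away F) s) := IsLocalization.map_units _ s
  set t := algebraMap A (Localization.Away F) s with ht
  set E := localizedDerivation D F
  set E' := localizedDerivation D' F
  have hc : ∀ b : A, E (E' (algebraMap A _ b)) = E' (E (algebraMap A _ b)) := fun b => by
    simp only [E, E', localizedDerivation_algebraMap, h]
  have h1 : E (E' (g * t)) = E' (E (g * t)) := by rw [hs]; exact hc a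
  have h2 : E (E' t) = E' (E t) := hc s
  simp only [Derivation.leibniz, map_add, smul_eq_mul] at h1
  rw [h2] at h1
  apply hu.mul_left_cancel
  linear_combination h1

theorem derivation_logDeriv_comm (E E' : Derivation R A A) (u : A) (hu : IsUnit u)
    (h : E (E' u) = E' (E u)) :
    E (E' u * Ring.inverse u) = E' (E u * Ring.inverse u) := by
  have hv : u * Ring.inverse u = 1 := Ring.mul_inverse_cancel _ hu
  generalize Ring.inverse u = v at hv ⊢
  have hd : ∀ T : Derivation R A A, T v = -(v * v * T u) := fun T => by
    have h := congrArg T hv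
    simp only [Derivation.leibniz, smul_eq_mul, Derivation.map_one_eq_zero] at h
    linear_combination v * h - T v * hv
  simp only [Derivation.leibniz, smul_eq_mul, hd, h]
  ring

theorem derivation_sum_logDeriv_comm {p : ℕ} (E E' : Derivation R A A) (c : Fin p → R)
    (u : Fin p → A) (hu : ∀ k, IsUnit (u k)) (h : ∀ k, E (E' (u k)) = E' (E (u k))) :
    E (∑ k, c k • (E' (u k) * Ring.inverse (u k))) =
      E' (∑ k, c k • (E (u k) * Ring.inverse (u k))) := by
  simp only [map_sum, Derivation.map_smul]
  exact Finset.sum_congr rfl fun k _ => by rw [derivation_logDeriv_comm E E' _ (hu k) (h k)]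

end LocalizedDerivation

/-! ### The module `ℂ[x, s, 1/F] f₁^{s₁} ⋯ f_p^{s_p}` and the Bernstein ideal -/

/-- The polynomial ring `ℂ[s₁, …, s_p][x₁, …, xₙ]`. -/
abbrev CoordRing (n p : ℕ) : Type := MvPolynomial (Fin n) (MvPolynomial (Fin p) ℂ)

section Bernstein

variable {n p : ℕ} (f : Fin p → MvPolynomial (Fin n) ℂ)

/-- The polynomial `f_j`, viewed in `ℂ[s₁, …, s_p][x₁, …, xₙ]`. -/
def paramPoly (j : Fin p) : CoordRing n p :=
  MvPolynomial.map C (f j)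

/-- The product `F = f₁ ⋯ f_p` in `ℂ[s₁, …, s_p][x₁, …, xₙ]`. -/
def paramProd : CoordRing n p := ∏ j, paramPoly f j

/-- The free `ℂ[x, s, 1/F]`-module of rank one `ℂ[x, s, 1/F] f₁^{s₁} ⋯ f_p^{s_p}`;
the element `g` of `ℂ[x, s, 1/F]` stands for `g f₁^{s₁} ⋯ f_p^{s_p}`. -/
abbrev PowerModule : Type := Localization.Away (paramProd f)

/-- The partial derivative `∂/∂xᵢ` on `ℂ[x, s, 1/F]`. -/
def partialDeriv (i : Fin n) :
    Derivation (MvPolynomial (Fin p) ℂ) (PowerModule f) (PowerModule f) :=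
  localizedDerivation (pderiv i) (paramProd f)

/-- The logarithmic derivative `∑ⱼ sⱼ (∂fⱼ/∂xᵢ) / fⱼ` of `f₁^{s₁} ⋯ f_p^{s_p}`, an element of
`ℂ[x, s, 1/F]` (each `fⱼ` is invertible there). -/
def powLogDeriv (i : Fin n) : PowerModule f :=
  ∑ j, (X j : MvPolynomial (Fin p) ℂ) •
    (partialDeriv f i (algebraMap (CoordRing n p) _ (paramPoly f j)) *
      Ring.inverse (algebraMap (CoordRing n p) (PowerModule f) (paramPoly f j)))

theorem isUnit_paramPoly (j : Fin p) :
    IsUnit (algebraMap (CoordRing n p) (PowerModule f) (paramPoly f j)) := by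
  have h : IsUnit (algebraMap (CoordRing n p) (PowerModule f) (paramProd f)) :=
    IsLocalization.Away.algebraMap_isUnit _
  exact isUnit_of_dvd_unit (map_dvd _ (Finset.dvd_prod_of_mem _ (Finset.mem_univ j))) h

/-- Multiplication by `xᵢ` on `ℂ[x, s, 1/F] f₁^{s₁} ⋯ f_p^{s_p}`. -/
def xAction (i : Fin n) : Module.End (MvPolynomial (Fin p) ℂ) (PowerModule f) :=
  LinearMap.mulLeft _ (algebraMap (CoordRing n p) (PowerModule f) (X i))

/-- The action of `∂/∂xᵢ` on `ℂ[x, s, 1/F] f₁^{s₁} ⋯ f_p^{s_p}`: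
`∂ᵢ (g f^s) = (∂ᵢ g + g ∑ⱼ sⱼ (∂ᵢ fⱼ) / fⱼ) f^s`. -/
def dAction (i : Fin n) : Module.End (MvPolynomial (Fin p) ℂ) (PowerModule f) :=
  (partialDeriv f i).toLinearMap + LinearMap.mulLeft _ (powLogDeriv f i)

theorem partialDeriv_comm (i j : Fin n) (g : PowerModule f) :
    partialDeriv f i (partialDeriv f j g) = partialDeriv f j (partialDeriv f i g) := by
  apply localizedDerivation_comm
  intro a
  have h : ⁅(pderiv i : Derivation (MvPolynomial (Fin p) ℂ) _ _), pderiv j⁆ =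
      (0 : Derivation (MvPolynomial (Fin p) ℂ)
        (CoordRing n p) _) := by
    apply MvPolynomial.derivation_ext
    intro k
    simp [Derivation.commutator_apply, pderiv_X, Pi.single_apply, apply_ite]
  have h' := congrArg (fun E => E a) h
  simpa [Derivation.commutator_apply, sub_eq_zero] using h'

theorem partialDeriv_powLogDeriv (i j : Fin n) :
    partialDeriv f i (powLogDeriv f j) = partialDeriv f j (powLogDeriv f i) :=
  derivation_sum_logDeriv_comm (partialDeriv f i) (partialDeriv f j) _
    (fun k => algebraMap (CoordRing n p) (PowerModule f) (paramPoly f k))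
    (isUnit_paramPoly f) (fun _ => partialDeriv_comm f i j _)

theorem xAction_apply (i : Fin n) (g : PowerModule f) :
    xAction f i g = algebraMap (CoordRing n p) (PowerModule f) (X i) * g := rfl

theorem dAction_apply (i : Fin n) (g : PowerModule f) :
    dAction f i g = partialDeriv f i g + powLogDeriv f i * g := rfl

/-- The action of `A_n(ℂ)[s₁, …, s_p]` on `ℂ[x, s, 1/F] f₁^{s₁} ⋯ f_p^{s_p}`. -/
def weylAction : WeylAlgebra (MvPolynomial (Fin p) ℂ) n →ₐ[MvPolynomial (Fin p) ℂ]
    Module.End (MvPolynomial (Fin p) ℂ) (PowerModule f) :=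
  WeylAlgebra.lift (xAction f) (dAction f)
    (fun i j => LinearMap.ext fun g => by
      simp only [xAction_apply, Module.End.mul_apply]
      ring)
    (fun i j => LinearMap.ext fun g => by
      simp only [dAction_apply, Module.End.mul_apply, map_add, Derivation.leibniz, smul_eq_mul,
        partialDeriv_comm f i j g, partialDeriv_powLogDeriv f i j]
      ring)
    (fun i j => LinearMap.ext fun g => by
      have hx : partialDeriv f i (algebraMap (CoordRing n p) (PowerModule f) (X j)) =
          if i = j then 1 else 0 := by
        rw [partialDeriv, localizedDerivation_algebraMap, pderiv_X]
        by_cases h : i = j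
        · subst h; simp
        · simp [h, Ne.symm h]
      by_cases h : i = j
      · simp only [h, if_true] at hx
        simp only [dAction_apply, xAction_apply, Module.End.mul_apply, LinearMap.add_apply,
          Derivation.leibniz, smul_eq_mul, hx, h, if_true, Module.End.one_apply]
        ring
      · simp only [h, if_false] at hx
        simp only [dAction_apply, xAction_apply, Module.End.mul_apply, LinearMap.add_apply,
          Derivation.leibniz, smul_eq_mul, hx, h, if_false, LinearMap.zero_apply]
        ring)

/-- The element `f₁^{s₁} ⋯ f_p^{s_p}`. -/
def powS : PowerModule f := 1

/-- The element `f₁^{s₁+1} ⋯ f_p^{s_p+1} = F f₁^{s₁} ⋯ f_p^{s_p}`. -/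
def powSAddOne : PowerModule f :=
  algebraMap (CoordRing n p) (PowerModule f) (paramProd f)

/-- The Bernstein ideal of `(f₁, …, f_p)`: the polynomials `b ∈ ℂ[s₁, …, s_p]` such that
`b f₁^{s₁} ⋯ f_p^{s_p} ∈ A_n(ℂ)[s₁, …, s_p] f₁^{s₁+1} ⋯ f_p^{s_p+1}`. -/
def bernsteinIdeal : Ideal (MvPolynomial (Fin p) ℂ) where
  carrier := {b | ∃ P : WeylAlgebra (MvPolynomial (Fin p) ℂ) n,
    b • powS f = weylAction f P (powSAddOne f)}
  zero_mem' := ⟨0, by simp⟩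
  add_mem' := by
    rintro b c ⟨P, hP⟩ ⟨Q, hQ⟩
    exact ⟨P + Q, by rw [add_smul, hP, hQ, map_add, LinearMap.add_apply]⟩
  smul_mem' := by
    rintro c b ⟨P, hP⟩
    exact ⟨c • P, by rw [smul_eq_mul, mul_smul, hP, map_smul, LinearMap.smul_apply]⟩

end Bernstein

/-! ### Generic families of linear forms -/

/-- A family of linear forms on `ℂⁿ` is generic if any `n` of them are linearly independent. -/
def IsGenericFamily {n p : ℕ} (l : Fin p → Module.Dual ℂ (Fin n → ℂ)) : Prop :=
  ∀ K : Finset (Fin p), K.card = n → LinearIndependent ℂ (fun k : K => l k)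

/-- A linear form on `ℂⁿ` as a polynomial of `ℂ[x₁, …, xₙ]`. -/
def linearFormPoly {n : ℕ} (l : Module.Dual ℂ (Fin n → ℂ)) : MvPolynomial (Fin n) ℂ :=
  ∑ i, C (l (Pi.single i 1)) * X i

end

/-! Write `F = l₁ ⋯ l_{n+1}` and work with the Laurent monomials `l^a`, `a ∈ ℤ^{n+1}`, which span
`ℂ[x, s, 1/F]` over `ℂ[s]`. A constant vector field `v` acts on the class of `l^a · l^s` by
`∂_v l^a = ∑ⱼ l_j(v) (s_j + a_j) l^{a - e_j}` (`sum_smul_dAction_monomial`), and multiplication by a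
coordinate is a combination of the shifts `l^a ↦ l^{a + e_k}`.

*The product lies in the ideal* (`prod_mem_bernsteinIdeal`). By the Euler relation
`∑ᵢ ∂ᵢ xᵢ l^a = (∑ s_j + n + |a|) l^a`, multiplication by `∑ s_j + n + m` moves the monomials of
degree `m` into the submodule generated by those of degree `m + 1`; so the second product moves
`1` to degree `n + 1`. A monomial of degree at least `n + 1` that misses `l_j` has some `a_i ≥ 2`.
Let `v` be a vector with `l_j(v) = 1` on which all forms but `l_i, l_j` vanish. Then
`∂_v l^{a + e_j} = (s_j + 1) l^a + l_i(v) (s_i + a_i) l^{a + e_j - e_i}`, and iterating this replaces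
`∏ (s_j + 1) l^a` by multiples of `F` (`prod_smul_monomial_mem`).

*Every element of the ideal is a multiple of the product.* The linear factors are pairwise
non-associated primes, so it suffices that an element `b` vanishes at a Zariski dense set of points
of each of the hyperplanes.

For `s_j = -1`: modulo `s_j + 1`, the monomials with `a_j ≥ 1` span a submodule stable under the
Weyl algebra, since the term of a derivative that leaves it has the coefficient `s_j + 1`. It
contains `F`, hence `b`, and a constant that vanishes along `l_j = 0` is zero
(`eval_eq_zero_of_smul_one_mem`).

For `∑ s_j = -n - k` with `0 ≤ k ≤ n`: let `∑ c_j l_j = 0` be the linear relation of the family, and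
let `α` be a point of the hyperplane without integral coordinates. The functional
`l^a ↦ ∏ Γ(α_j + a_j + 1) c_j^{-a_j}` for `|a| = k`, and `l^a ↦ 0` in other degrees, is compatible
with the relation and vanishes on derivatives; both facts are the functional equation of `Γ`
(`mul_gammaWeight_sub_single`). It models the integral of `l^α` over a twisted cycle of the
projectivized arrangement. Apply it to `l₁^k (b l^s) = l₁^k (P F l^s)` and pass to the
adjoint of `P`: on the right one obtains its value at a polynomial multiple of `F`, which is zero
because `n + 1 > k`; on the left `b(α)` times a product of values of `Γ`, which is not zero. -/

noncomputable section

/-! ### Linear algebra of generic families -/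

namespace IsGenericFamily

variable {n : ℕ} {l : Fin (n + 1) → Module.Dual ℂ (Fin n → ℂ)}

theorem linearIndependent_erase (hl : IsGenericFamily l) (i : Fin (n + 1)) :
    LinearIndependent ℂ (fun k : (Finset.univ.erase i : Finset (Fin (n + 1))) => l k) :=
  hl _ (by simp [Finset.card_erase_of_mem])

theorem span_erase (hl : IsGenericFamily l) (i : Fin (n + 1)) :
    Submodule.span ℂ (Set.range
      (fun k : (Finset.univ.erase i : Finset (Fin (n + 1))) => l k)) = ⊤ :=
  (hl.linearIndependent_erase i).span_eq_top_of_card_eq_finrank'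
    (by simp [Subspace.dual_finrank_eq])

/-- Omitting one form from a generic family leaves a basis of the dual space, so a linear map on
the dual space may be prescribed freely on the remaining forms. -/
theorem exists_linearMap (hl : IsGenericFamily l) (i : Fin (n + 1))
    {B : Type} [AddCommGroup B] [Module ℂ B] (Y : Fin (n + 1) → B) :
    ∃ W : Module.Dual ℂ (Fin n → ℂ) →ₗ[ℂ] B, ∀ k, k ≠ i → W (l k) = Y k := by
  let b := Module.Basis.mk (hl.linearIndependent_erase i) (hl.span_erase i).ge
  refine ⟨b.constr ℂ fun k => Y k, fun k hk => ?_⟩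
  have hb : b ⟨k, by simp [hk]⟩ = l k := by simp [b]
  rw [← hb, b.constr_basis]

theorem exists_eq_sum (hl : IsGenericFamily l) (φ : Module.Dual ℂ (Fin n → ℂ)) :
    ∃ d : Fin (n + 1) → ℂ, φ = ∑ k, d k • l k := by
  have h : φ ∈ Submodule.span ℂ (Set.range l) := by
    refine Submodule.span_mono ?_ ((hl.span_erase 0).ge (Submodule.mem_top (x := φ)))
    rintro _ ⟨k, rfl⟩
    exact ⟨k, rfl⟩
  obtain ⟨d, hd⟩ := (Submodule.mem_span_range_iff_exists_fun ℂ).1 h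
  exact ⟨d, hd.symm⟩

/-- The `n + 1` forms satisfy a linear relation, and by genericity none of its coefficients
vanishes. -/
theorem exists_relation (hl : IsGenericFamily l) :
    ∃ c : Fin (n + 1) → ℂ, (∀ j, c j ≠ 0) ∧ ∑ j, c j • l j = 0 := by
  have h : ¬ LinearIndependent ℂ l := fun h => by
    have := h.fintype_card_le_finrank
    simp [Subspace.dual_finrank_eq] at this
  obtain ⟨c, hc, i, hi⟩ := Fintype.not_linearIndependent_iff.1 h
  refine ⟨c, fun j hj => hi ?_, hc⟩
  -- a relation with `c j = 0` is a relation between `n` of the forms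
  have hi' : i ∈ Finset.univ.erase j :=
    Finset.mem_erase.2 ⟨fun hij => hi (hij ▸ hj), Finset.mem_univ i⟩
  refine Fintype.linearIndependent_iff.1 (hl.linearIndependent_erase j) (fun k => c k) ?_
    ⟨i, hi'⟩
  rw [Finset.sum_coe_sort (Finset.univ.erase j) (fun k => c k • l k),
    Finset.sum_erase _ (by rw [hj, zero_smul]), hc]

/-- If all the values `Y j` satisfy the linear relation between the forms, a linear map on the
dual space takes them on the whole family. -/
theorem exists_linearMap_of_relation (hl : IsGenericFamily l) {c : Fin (n + 1) → ℂ}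
    (hc : ∀ j, c j ≠ 0) (hcl : ∑ j, c j • l j = 0) {B : Type} [AddCommGroup B] [Module ℂ B]
    (Y : Fin (n + 1) → B) (hY : ∑ j, c j • Y j = 0) :
    ∃ W : Module.Dual ℂ (Fin n → ℂ) →ₗ[ℂ] B, ∀ k, W (l k) = Y k := by
  obtain ⟨W, hW⟩ := hl.exists_linearMap 0 Y
  refine ⟨W, fun k => ?_⟩
  by_cases hk : k = 0
  · subst hk
    have h := congrArg W hcl
    rw [map_sum, map_zero, ← hY, ← sub_eq_zero, ← Finset.sum_sub_distrib,
      Finset.sum_eq_single 0 (fun j _ hj => by rw [map_smul, hW j hj, sub_self]) (by simp),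
      map_smul, ← smul_sub, smul_eq_zero] at h
    exact sub_eq_zero.1 (h.resolve_left (hc 0))
  · exact hW k hk

theorem exists_vector (hl : IsGenericFamily l) (i : Fin (n + 1)) (y : Fin (n + 1) → ℂ) :
    ∃ v : Fin n → ℂ, ∀ k, k ≠ i → l k v = y k := by
  obtain ⟨W, hW⟩ := hl.exists_linearMap i y
  refine ⟨(Module.evalEquiv ℂ (Fin n → ℂ)).symm W, fun k hk => ?_⟩
  rw [← hW k hk, Module.apply_evalEquiv_symm_apply]

/-- For `n ≥ 2` some point of a hyperplane of the family lies on no other one. -/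
theorem exists_generic_point (hn : 2 ≤ n) (hl : IsGenericFamily l) (j : Fin (n + 1)) :
    ∃ v : Fin n → ℂ, l j v = 0 ∧ ∀ k, k ≠ j → l k v ≠ 0 := by
  obtain ⟨c, hc, hcl⟩ := hl.exists_relation
  have : Nontrivial (Fin (n + 1)) := Fin.nontrivial_iff_two_le.2 (by omega)
  obtain ⟨i, hij⟩ := exists_ne j
  -- with the value `1 / c k` for all `k ≠ i, j`, the relation gives `c i * l i v = -(n - 1) ≠ 0`
  obtain ⟨v, hv⟩ := hl.exists_vector i (fun k => if k = j then 0 else (c k)⁻¹)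
  refine ⟨v, by simpa using hv j hij.symm, fun k hk => ?_⟩
  by_cases hki : k = i
  · subst hki
    intro h0
    have h := congrArg (fun φ : Module.Dual ℂ (Fin n → ℂ) => φ v) hcl
    have h1 : ∑ m, c m * l m v = ∑ m, if m = j ∨ m = k then 0 else (1 : ℂ) := by
      refine Finset.sum_congr rfl fun m _ => ?_
      by_cases hmk : m = k
      · simp [hmk, h0]
      · rw [hv m hmk]
        by_cases hmj : m = j <;> simp [hmj, hmk, hc]
    have h2 : (Finset.univ.filter fun m => ¬ (m = j ∨ m = k)).card = n - 1 := by
      have : (Finset.univ.filter fun m => ¬ (m = j ∨ m = k)) = Finset.univ \ {j, k} := by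
        ext m; simp
      rw [this, Finset.card_sdiff_of_subset (Finset.subset_univ _), Finset.card_pair hk.symm]
      simp
    simp only [LinearMap.sum_apply, LinearMap.smul_apply, smul_eq_mul, LinearMap.zero_apply] at h
    rw [h1, Finset.sum_ite, Finset.sum_const_zero, zero_add, Finset.sum_const, h2, nsmul_one,
      Nat.cast_eq_zero] at h
    omega
  · rw [hv k hki, if_neg hk]
    exact inv_ne_zero (hc k)

end IsGenericFamily

/-! ### Monomials in the factors and the Weyl algebra action -/

theorem WeylAlgebra.induction {R : Type} [CommRing R] {n : ℕ} {motive : WeylAlgebra R n → Prop}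
    (algebraMap : ∀ r, motive (algebraMap R _ r))
    (x : ∀ i, motive (WeylAlgebra.x R n i)) (d : ∀ i, motive (WeylAlgebra.d R n i))
    (add : ∀ P Q, motive P → motive Q → motive (P + Q))
    (mul : ∀ P Q, motive P → motive Q → motive (P * Q)) (P : WeylAlgebra R n) : motive P := by
  obtain ⟨P, rfl⟩ := RingQuot.mkAlgHom_surjective R (WeylRel R n) P
  induction P using FreeAlgebra.induction with
  | grade0 r => exact (AlgHom.commutes (RingQuot.mkAlgHom R (WeylRel R n)) r).symm ▸ algebraMap r
  | grade1 w =>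
    cases w with
    | x i => exact x i
    | d i => exact d i
  | mul P Q hP hQ => exact (map_mul (RingQuot.mkAlgHom R (WeylRel R n)) P Q).symm ▸ mul _ _ hP hQ
  | add P Q hP hQ => exact (map_add (RingQuot.mkAlgHom R (WeylRel R n)) P Q).symm ▸ add _ _ hP hQ

section Monomials

variable {n p : ℕ} (f : Fin p → MvPolynomial (Fin n) ℂ)

/-- The element `f_j` as a unit of `ℂ[x, s, 1/F]`. -/
def factorUnit (j : Fin p) : (PowerModule f)ˣ := (isUnit_paramPoly f j).unit

/-- The Laurent monomial `f₁^{a₁} ⋯ f_p^{a_p}` in `ℂ[x, s, 1/F]`, for integers `a_j`. -/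
def factorMonomial (a : Fin p → ℤ) : PowerModule f :=
  ((∏ j, factorUnit f j ^ a j : (PowerModule f)ˣ) : PowerModule f)

theorem coe_factorUnit (j : Fin p) :
    (factorUnit f j : PowerModule f) = algebraMap (CoordRing n p) _ (paramPoly f j) := rfl

theorem algebraMap_C_mul (r : MvPolynomial (Fin p) ℂ) (g : PowerModule f) :
    algebraMap (CoordRing n p) (PowerModule f) (C r) * g = r • g := by
  rw [Algebra.smul_def, IsScalarTower.algebraMap_apply (MvPolynomial (Fin p) ℂ) (CoordRing n p)]
  rfl

theorem factorMonomial_zero : factorMonomial f 0 = 1 := by simp [factorMonomial]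

theorem factorMonomial_add (a b : Fin p → ℤ) :
    factorMonomial f (a + b) = factorMonomial f a * factorMonomial f b := by
  simp [factorMonomial, zpow_add, Finset.prod_mul_distrib]

theorem factorMonomial_nonneg (a : Fin p → ℤ) (ha : 0 ≤ a) :
    factorMonomial f a = algebraMap (CoordRing n p) _ (∏ j, paramPoly f j ^ (a j).toNat) := by
  rw [factorMonomial, Units.coe_prod, map_prod]
  refine Finset.prod_congr rfl fun j _ => ?_
  rw [map_pow, ← coe_factorUnit, ← Units.val_pow_eq_pow_val, ← zpow_natCast,
    Int.toNat_of_nonneg (ha j)]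

theorem factorMonomial_single (j : Fin p) (m : ℕ) :
    factorMonomial f (Pi.single j (m : ℤ)) = algebraMap (CoordRing n p) _ (paramPoly f j ^ m) := by
  rw [factorMonomial_nonneg f _ (Pi.single_nonneg.2 (by positivity)),
    Finset.prod_eq_single j (fun k _ hk => by simp [hk]) (by simp)]
  simp

theorem factorMonomial_const (m : ℕ) :
    factorMonomial f (fun _ => (m : ℤ)) = algebraMap (CoordRing n p) _ (paramProd f ^ m) := by
  rw [factorMonomial_nonneg f _ (fun _ => by simp), Finset.prod_pow]
  simp [paramProd]

theorem powSAddOne_eq_factorMonomial : powSAddOne f = factorMonomial f 1 := by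
  have h := factorMonomial_const f 1
  rw [pow_one] at h
  exact h.symm

/-- The logarithmic derivative of a product of integral powers of units. -/
theorem derivation_zpow_prod {R A : Type} [CommRing R] [CommRing A] [Algebra R A]
    (D : Derivation R A A) (u : Fin p → Aˣ) (a : Fin p → ℤ) :
    D ((∏ j, u j ^ a j : Aˣ) : A) =
      (∑ j, a j • (D (u j) * ((u j)⁻¹ : Aˣ))) * ((∏ j, u j ^ a j : Aˣ) : A) := by
  -- the logarithmic derivative turns products of units into sums
  let L : Aˣ →* Multiplicative A :=
    { toFun := fun w => Multiplicative.ofAdd (D w * ((w⁻¹ : Aˣ) : A))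
      map_one' := by simp
      map_mul' := fun w z => by
        rw [← ofAdd_add]
        congr 1
        rw [Units.val_mul, Derivation.leibniz, mul_inv, Units.val_mul, smul_eq_mul, smul_eq_mul]
        linear_combination (D z * ((z⁻¹ : Aˣ) : A)) * w.mul_inv
          + (D w * ((w⁻¹ : Aˣ) : A)) * z.mul_inv }
  have h := map_prod L (fun j => u j ^ a j) Finset.univ
  simp only [map_zpow] at h
  have h' := congrArg Multiplicative.toAdd h
  rw [toAdd_prod] at h'
  simp only [toAdd_zpow] at h'
  change D ((∏ j, u j ^ a j : Aˣ) : A) * (((∏ j, u j ^ a j)⁻¹ : Aˣ) : A) =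
    ∑ j, a j • (D (u j) * ((u j)⁻¹ : Aˣ)) at h'
  rw [← h', mul_assoc, Units.inv_mul, mul_one]

theorem factorMonomial_sub_single (a : Fin p → ℤ) (j : Fin p) :
    factorMonomial f (a - Pi.single j 1) =
      ((factorUnit f j)⁻¹ : (PowerModule f)ˣ) * factorMonomial f a := by
  have h := factorMonomial_single f j 1
  rw [pow_one, Nat.cast_one, ← coe_factorUnit] at h
  rw [Units.eq_inv_mul_iff_mul_eq, ← h, ← factorMonomial_add, add_sub_cancel]

theorem paramPoly_mul_factorMonomial (a : Fin p → ℤ) (j : Fin p) :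
    algebraMap (CoordRing n p) _ (paramPoly f j) * factorMonomial f a =
      factorMonomial f (a + Pi.single j 1) := by
  have h := factorMonomial_single f j 1
  rw [pow_one, Nat.cast_one] at h
  rw [factorMonomial_add, h, mul_comm]

theorem dAction_factorMonomial (i : Fin n) (a : Fin p → ℤ) :
    dAction f i (factorMonomial f a) =
      ∑ j, (X j + C (a j : ℂ) : MvPolynomial (Fin p) ℂ) •
        (algebraMap (CoordRing n p) (PowerModule f) (pderiv i (paramPoly f j)) *
          factorMonomial f (a - Pi.single j 1)) := by
  have hinv : ∀ j, Ring.inverse (algebraMap (CoordRing n p) (PowerModule f) (paramPoly f j)) =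
      ((factorUnit f j)⁻¹ : (PowerModule f)ˣ) := fun j => by
    rw [← coe_factorUnit, Ring.inverse_unit]
  rw [dAction_apply, powLogDeriv]
  have h := derivation_zpow_prod (partialDeriv f i) (factorUnit f) a
  rw [← factorMonomial] at h
  rw [h, ← add_mul, ← Finset.sum_add_distrib, Finset.sum_mul]
  refine Finset.sum_congr rfl fun j _ => ?_
  rw [hinv, factorMonomial_sub_single, coe_factorUnit, partialDeriv, localizedDerivation_algebraMap]
  have hz : ∀ g : PowerModule f, a j • g = (C (a j : ℂ) : MvPolynomial (Fin p) ℂ) • g := by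
    intro g
    rw [← Int.cast_smul_eq_zsmul (MvPolynomial (Fin p) ℂ)]
    simp
  rw [hz, ← add_smul, add_comm, smul_mul_assoc, mul_assoc]

theorem weylAction_x (i : Fin n) (g : PowerModule f) :
    weylAction f (WeylAlgebra.x _ n i) g = xAction f i g := by
  rw [weylAction, WeylAlgebra.lift_x]

theorem weylAction_d (i : Fin n) (g : PowerModule f) :
    weylAction f (WeylAlgebra.d _ n i) g = dAction f i g := by
  rw [weylAction, WeylAlgebra.lift_d]

theorem weylAction_mem (N : Submodule (MvPolynomial (Fin p) ℂ) (PowerModule f))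
    (hx : ∀ i, ∀ g ∈ N, xAction f i g ∈ N) (hd : ∀ i, ∀ g ∈ N, dAction f i g ∈ N)
    (P : WeylAlgebra (MvPolynomial (Fin p) ℂ) n) : ∀ g ∈ N, weylAction f P g ∈ N := by
  induction P using WeylAlgebra.induction with
  | algebraMap r =>
    intro g hg
    rw [AlgHom.commutes]
    exact N.smul_mem r hg
  | x i => exact fun g hg => (weylAction_x f i g).symm ▸ hx i g hg
  | d i => exact fun g hg => (weylAction_d f i g).symm ▸ hd i g hg
  | mul P Q hP hQ =>
    intro g hg
    rw [map_mul]
    exact hP _ (hQ g hg)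
  | add P Q hP hQ =>
    intro g hg
    rw [map_add]
    exact N.add_mem (hP g hg) (hQ g hg)

end Monomials

/-! ### Monomials in linear forms -/

section LinearForms

variable {n p : ℕ} (l : Fin p → Module.Dual ℂ (Fin n → ℂ))

/-- The `i`-th coordinate function as a linear form. -/
abbrev coordForm (n : ℕ) (i : Fin n) : Module.Dual ℂ (Fin n → ℂ) := LinearMap.proj i

theorem sum_smul_coordForm (φ : Module.Dual ℂ (Fin n → ℂ)) :
    ∑ i, φ (Pi.single i 1) • coordForm n i = φ := by
  refine LinearMap.pi_ext' fun i => LinearMap.ext_ring ?_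
  simp [Pi.single_apply]

theorem pderiv_paramPoly (i : Fin n) (j : Fin p) :
    pderiv i (paramPoly (fun j => linearFormPoly (l j)) j) = C (C (l j (Pi.single i 1))) := by
  simp [paramPoly, linearFormPoly, pderiv_X, Pi.single_apply, Derivation.leibniz]

theorem dAction_linearForm_monomial (i : Fin n) (a : Fin p → ℤ) :
    dAction (fun j => linearFormPoly (l j)) i (factorMonomial _ a) =
      ∑ j, (C (l j (Pi.single i 1)) * (X j + C (a j : ℂ)) : MvPolynomial (Fin p) ℂ) •
        factorMonomial (fun j => linearFormPoly (l j)) (a - Pi.single j 1) := by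
  rw [dAction_factorMonomial]
  refine Finset.sum_congr rfl fun j _ => ?_
  rw [pderiv_paramPoly, algebraMap_C_mul, smul_smul, mul_comm]

/-- If a coordinate is a combination of the forms, so is the effect of multiplying by it. -/
theorem xAction_linearForm_monomial {i : Fin n} {d : Fin p → ℂ}
    (hd : coordForm n i = ∑ k, d k • l k) (a : Fin p → ℤ) :
    xAction (fun j => linearFormPoly (l j)) i (factorMonomial _ a) =
      ∑ k, (C (d k) : MvPolynomial (Fin p) ℂ) •
        factorMonomial (fun j => linearFormPoly (l j)) (a + Pi.single k 1) := by
  have hX : (X i : CoordRing n p) =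
      ∑ k, C (C (d k)) * paramPoly (fun j => linearFormPoly (l j)) k := by
    have h : (X i : MvPolynomial (Fin n) ℂ) = ∑ k, C (d k) * linearFormPoly (l k) := by
      simp only [linearFormPoly, Finset.mul_sum]
      rw [Finset.sum_comm]
      have hc : ∀ m, ∑ k, d k * l k (Pi.single m 1) = if m = i then 1 else 0 := fun m => by
        have := congrArg (fun φ : Module.Dual ℂ (Fin n → ℂ) => φ (Pi.single m 1)) hd
        simpa [Pi.single_apply, eq_comm] using this.symm
      simp only [← mul_assoc, ← C_mul, ← Finset.sum_mul, ← map_sum, hc]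
      simp
    simpa [paramPoly] using congrArg (MvPolynomial.map (C : ℂ →+* MvPolynomial (Fin p) ℂ)) h
  rw [xAction_apply, hX, map_sum, Finset.sum_mul]
  refine Finset.sum_congr rfl fun k _ => ?_
  rw [map_mul, mul_assoc, paramPoly_mul_factorMonomial, algebraMap_C_mul]

/-- The derivative in the direction `v`. -/
theorem sum_smul_dAction_monomial (v : Fin n → ℂ) (a : Fin p → ℤ) :
    ∑ i, (C (v i) : MvPolynomial (Fin p) ℂ) •
        dAction (fun j => linearFormPoly (l j)) i (factorMonomial _ a) =
      ∑ j, (C (l j v) * (X j + C (a j : ℂ)) : MvPolynomial (Fin p) ℂ) •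
        factorMonomial (fun j => linearFormPoly (l j)) (a - Pi.single j 1) := by
  simp only [dAction_linearForm_monomial, Finset.smul_sum, smul_smul]
  rw [Finset.sum_comm]
  refine Finset.sum_congr rfl fun j _ => ?_
  rw [← Finset.sum_smul]
  congr 1
  have h : l j v = ∑ i, v i * l j (Pi.single i 1) := by
    conv_lhs => rw [← sum_smul_coordForm (l j)]
    simp [mul_comm]
  rw [h, map_sum, Finset.sum_mul]
  simp [mul_assoc]

end LinearForms

/-! ### The product annihilates the class of the power -/

section UpperBound

/-- The cyclic module `A_n(ℂ)[s₁, …, s_p] f₁^{s₁+1} ⋯ f_p^{s_p+1}`. -/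
def shiftedSubmodule {n p : ℕ} (f : Fin p → MvPolynomial (Fin n) ℂ) :
    Submodule (MvPolynomial (Fin p) ℂ) (PowerModule f) where
  carrier := {g | ∃ P : WeylAlgebra (MvPolynomial (Fin p) ℂ) n,
    g = weylAction f P (powSAddOne f)}
  zero_mem' := ⟨0, by simp⟩
  add_mem' := by
    rintro g h ⟨P, rfl⟩ ⟨Q, rfl⟩
    exact ⟨P + Q, by rw [map_add, LinearMap.add_apply]⟩
  smul_mem' := by
    rintro c g ⟨P, rfl⟩
    exact ⟨c • P, by rw [map_smul, LinearMap.smul_apply]⟩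

section

variable {n p : ℕ} (f : Fin p → MvPolynomial (Fin n) ℂ)

theorem mem_bernsteinIdeal_iff (b : MvPolynomial (Fin p) ℂ) :
    b ∈ bernsteinIdeal f ↔ b • (1 : PowerModule f) ∈ shiftedSubmodule f := Iff.rfl

theorem xAction_mem_shiftedSubmodule (i : Fin n) {g : PowerModule f}
    (hg : g ∈ shiftedSubmodule f) : xAction f i g ∈ shiftedSubmodule f := by
  obtain ⟨P, rfl⟩ := hg
  exact ⟨WeylAlgebra.x _ n i * P, by rw [map_mul, Module.End.mul_apply, weylAction_x]⟩

theorem dAction_mem_shiftedSubmodule (i : Fin n) {g : PowerModule f}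
    (hg : g ∈ shiftedSubmodule f) : dAction f i g ∈ shiftedSubmodule f := by
  obtain ⟨P, rfl⟩ := hg
  exact ⟨WeylAlgebra.d _ n i * P, by rw [map_mul, Module.End.mul_apply, weylAction_d]⟩

theorem algebraMap_mul_mem_shiftedSubmodule (q : CoordRing n p) {g : PowerModule f}
    (hg : g ∈ shiftedSubmodule f) : algebraMap _ (PowerModule f) q * g ∈ shiftedSubmodule f := by
  induction q using MvPolynomial.induction_on generalizing g with
  | C r =>
    have h := (shiftedSubmodule f).smul_mem r hg
    rwa [← algebraMap_C_mul] at h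
  | add q r hq hr =>
    rw [map_add, add_mul]
    exact add_mem (hq hg) (hr hg)
  | mul_X q i hq =>
    rw [map_mul, mul_assoc]
    exact hq (xAction_mem_shiftedSubmodule f i hg)

theorem factorMonomial_mem_shiftedSubmodule {a : Fin p → ℤ} (ha : ∀ j, 1 ≤ a j) :
    factorMonomial f a ∈ shiftedSubmodule f := by
  have h : a = (a - 1) + 1 := by simp
  rw [h, factorMonomial_add, ← powSAddOne_eq_factorMonomial,
    factorMonomial_nonneg f _ (fun j => by simpa using ha j)]
  exact algebraMap_mul_mem_shiftedSubmodule f _ ⟨1, by simp⟩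

end

variable {n : ℕ} {l : Fin (n + 1) → Module.Dual ℂ (Fin n → ℂ)}

/-- In degree at least `n + 1` a monomial that misses the factors indexed by `Z` has some exponent
at least `2`. Deriving in a direction that is tangent to all hyperplanes except the `j`-th, with
`j ∈ Z`, and the one of that exponent expresses `s_j + 1` times the monomial through monomials
that miss fewer factors. -/
theorem prod_smul_monomial_mem (hl : IsGenericFamily l) (Z : Finset (Fin (n + 1))) :
    ∀ a : Fin (n + 1) → ℤ, (∀ j ∈ Z, a j = 0) → (∀ j, j ∉ Z → 1 ≤ a j) →
      (n : ℤ) + 1 ≤ ∑ j, a j →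
      (∏ j ∈ Z, (X j + 1) : MvPolynomial (Fin (n + 1)) ℂ) •
        factorMonomial (fun j => linearFormPoly (l j)) a ∈
          shiftedSubmodule (fun j => linearFormPoly (l j)) := by
  induction Z using Finset.induction with
  | empty =>
    intro a _ h1 _
    rw [Finset.prod_empty, one_smul]
    exact factorMonomial_mem_shiftedSubmodule _ fun j => h1 j (by simp)
  | insert j Z hj ih =>
    intro a h0 h1 hs
    have haj : a j = 0 := h0 j (Finset.mem_insert_self j Z)
    -- pigeonhole: at most `n` exponents are nonzero
    obtain ⟨i, hi⟩ : ∃ i, 2 ≤ a i := by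
      by_contra! h
      have h2 : ∑ k, a k ≤ ∑ k ∈ Finset.univ.erase j, 1 := by
        rw [← Finset.sum_erase _ haj]
        exact Finset.sum_le_sum fun k _ => by have := h k; omega
      simp [Finset.card_erase_of_mem] at h2
      omega
    have hij : i ≠ j := by rintro rfl; omega
    have hiZ : i ∉ Z := fun h => by
      have := h0 i (Finset.mem_insert_of_mem h); omega
    obtain ⟨v, hv⟩ := hl.exists_vector i (Pi.single j 1)
    have hvj : l j v = 1 := by rw [hv j hij.symm, Pi.single_eq_same]
    have key := sum_smul_dAction_monomial l v (a + Pi.single j 1)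
    rw [Finset.sum_eq_add j i hij.symm
      (fun k _ hk => by rw [hv k hk.2, Pi.single_eq_of_ne hk.1]; simp) (by simp) (by simp),
      add_sub_cancel_right, hvj, C_1, one_mul, Pi.add_apply, Pi.single_eq_same, haj, zero_add,
      Int.cast_one, C_1] at key
    rw [Finset.prod_insert hj, mul_comm, mul_smul, eq_sub_of_add_eq key.symm, smul_sub,
      Finset.smul_sum]
    refine sub_mem (sum_mem fun m _ => ?_) ?_
    · rw [smul_comm, ← map_smul]
      refine Submodule.smul_mem _ _ (dAction_mem_shiftedSubmodule _ m (ih _ ?_ ?_ ?_))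
      · intro k hk
        have hkj : k ≠ j := fun h => hj (h ▸ hk)
        simp [hkj, h0 k (Finset.mem_insert_of_mem hk)]
      · intro k hk
        by_cases hkj : k = j
        · subst hkj; simp [haj]
        · simpa [hkj] using h1 k (by simp [hkj, hk])
      · simp only [Pi.add_apply, Finset.sum_add_distrib, Finset.sum_pi_single', Finset.mem_univ,
          if_true]
        omega
    · rw [smul_comm]
      refine Submodule.smul_mem _ _ (ih _ ?_ ?_ ?_)
      · intro k hk
        have hkj : k ≠ j := fun h => hj (h ▸ hk)
        have hki : k ≠ i := fun h => hiZ (h ▸ hk)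
        simp [hkj, hki, h0 k (Finset.mem_insert_of_mem hk)]
      · intro k hk
        by_cases hkj : k = j
        · subst hkj; simp [haj, hij.symm]
        · by_cases hki : k = i
          · subst hki
            simp [hkj]; omega
          · simpa [hkj, hki] using h1 k (by simp [hkj, hk])
      · simp only [Pi.add_apply, Pi.sub_apply, Finset.sum_add_distrib, Finset.sum_sub_distrib]
        simpa using hs

/-- The Euler relation `∑ᵢ ∂ᵢ xᵢ m = (s₁ + ⋯ + s_{n+1} + n + deg m) m`. -/
theorem sum_dAction_xAction_monomial (a : Fin (n + 1) → ℤ) :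
    ∑ i, dAction (fun j => linearFormPoly (l j)) i (xAction _ i (factorMonomial _ a)) =
      ((∑ j, X j) + C ((n : ℂ) + ((∑ j, a j : ℤ) : ℂ)) : MvPolynomial (Fin (n + 1)) ℂ) •
        factorMonomial (fun j => linearFormPoly (l j)) a := by
  set f := fun j => linearFormPoly (l j)
  have h1 : ∀ i, dAction f i (xAction f i (factorMonomial f a)) =
      factorMonomial f a + ∑ j, (X j + C (a j : ℂ) : MvPolynomial (Fin (n + 1)) ℂ) •
        (algebraMap (CoordRing n (n + 1)) _ (C (C (l j (Pi.single i 1))) * X i) *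
          factorMonomial f (a - Pi.single j 1)) := by
    intro i
    have h : dAction f i (xAction f i (factorMonomial f a)) =
        factorMonomial f a + xAction f i (dAction f i (factorMonomial f a)) := by
      have hx : partialDeriv f i (algebraMap (CoordRing n (n + 1)) _ (X i)) = 1 := by
        rw [partialDeriv, localizedDerivation_algebraMap, pderiv_X]
        simp
      simp only [dAction_apply, xAction_apply, Derivation.leibniz, smul_eq_mul, hx]
      ring
    rw [h, dAction_factorMonomial, map_sum]
    congr 1
    refine Finset.sum_congr rfl fun j _ => ?_
    rw [map_smul, xAction_apply, pderiv_paramPoly, map_mul, mul_left_comm, mul_assoc]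
  have h2 : ∀ j, paramPoly f j = ∑ i, C (C (l j (Pi.single i 1))) * X i := fun j => by
    simp [f, paramPoly, linearFormPoly]
  simp only [h1]
  rw [Finset.sum_add_distrib, Finset.sum_comm]
  simp only [← Finset.smul_sum, ← Finset.sum_mul, ← map_sum, ← h2]
  simp only [paramPoly_mul_factorMonomial, sub_add_cancel]
  rw [← Finset.sum_smul, Finset.sum_const, Finset.card_univ, Fintype.card_fin,
    ← Nat.cast_smul_eq_nsmul (MvPolynomial (Fin (n + 1)) ℂ), ← add_smul]
  congr 1
  rw [Finset.sum_add_distrib]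
  simp
  ring

/-- Descending induction on the degree `m` of the monomial, by means of the Euler relation. -/
theorem prod_mul_prod_smul_monomial_mem (hl : IsGenericFamily l) {m : ℕ} (hm : m ≤ n + 1) :
    ∀ a : Fin (n + 1) → ℤ, 0 ≤ a → ∑ j, a j = m →
      ((∏ j, (X j + 1)) * ∏ k ∈ Finset.Ico m (n + 1),
        ((∑ j, X j) + C ((n : ℂ) + (k : ℂ))) : MvPolynomial (Fin (n + 1)) ℂ) •
        factorMonomial (fun j => linearFormPoly (l j)) a ∈
          shiftedSubmodule (fun j => linearFormPoly (l j)) := by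
  induction hm using Nat.decreasingInduction with
  | self =>
    intro a ha hs
    have h := prod_smul_monomial_mem hl (Finset.univ.filter fun j => a j = 0) a (by simp)
      (fun j hj => by
        have : a j ≠ 0 := by simpa using hj
        have : 0 ≤ a j := ha j
        omega) (by rw [hs]; simp)
    rw [Finset.Ico_self, Finset.prod_empty, mul_one,
      ← Finset.prod_filter_mul_prod_filter_not _ (fun j => a j = 0), mul_comm, mul_smul]
    exact Submodule.smul_mem _ _ h
  | of_succ m hm ih =>
    intro a ha hs
    have h := sum_dAction_xAction_monomial (l := l) a
    rw [hs, Int.cast_natCast] at h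
    rw [Finset.prod_eq_prod_Ico_succ_bot hm, mul_left_comm, mul_comm, mul_smul, ← h,
      Finset.smul_sum]
    refine sum_mem fun i _ => ?_
    obtain ⟨d, hd⟩ := hl.exists_eq_sum (coordForm n i)
    rw [xAction_linearForm_monomial l hd, ← map_smul, Finset.smul_sum]
    refine dAction_mem_shiftedSubmodule _ i (sum_mem fun k _ => ?_)
    rw [smul_comm]
    refine Submodule.smul_mem _ _ (ih _ (add_nonneg ha (Pi.single_nonneg.2 zero_le_one)) ?_)
    simp [Finset.sum_add_distrib, hs]

theorem prod_mem_bernsteinIdeal (hl : IsGenericFamily l) :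
    ((∏ j, (X j + 1)) * ∏ k ∈ Finset.range (n + 1),
        ((∑ j, X j) + C ((n : ℂ) + (k : ℂ))) : MvPolynomial (Fin (n + 1)) ℂ) ∈
      bernsteinIdeal (fun j => linearFormPoly (l j)) := by
  have h := prod_mul_prod_smul_monomial_mem hl (Nat.zero_le (n + 1)) 0 le_rfl (by simp)
  rw [factorMonomial_zero] at h
  rwa [mem_bernsteinIdeal_iff, Finset.range_eq_Ico]

end UpperBound

/-! ### Specialization of the parameters and the coordinates -/

section Specialize

variable {n p : ℕ} {l : Fin p → Module.Dual ℂ (Fin n → ℂ)} {B : Type} [CommRing B] [Algebra ℂ B]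
  (α : Fin p → ℂ) (W : Module.Dual ℂ (Fin n → ℂ) →ₗ[ℂ] B)

/-- The ring homomorphism `ℂ[s][x] → B` with `s_j ↦ α_j` and `φ ↦ W φ` for each linear form `φ`
in `x`. -/
def specializeCoord : CoordRing n p →+* B :=
  eval₂Hom ((algebraMap ℂ B).comp (eval α)) (fun i => W (coordForm n i))

theorem specializeCoord_paramPoly (j : Fin p) :
    specializeCoord α W (paramPoly (fun j => linearFormPoly (l j)) j) = W (l j) := by
  conv_rhs => rw [← sum_smul_coordForm (l j)]
  simp [specializeCoord, paramPoly, linearFormPoly, Algebra.smul_def]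

variable {W}

theorem isUnit_specializeCoord_paramProd (hW : ∀ j, IsUnit (W (l j))) :
    IsUnit (specializeCoord α W (paramProd (fun j => linearFormPoly (l j)))) := by
  rw [paramProd, map_prod, IsUnit.prod_univ_iff]
  exact fun j => (specializeCoord_paramPoly (l := l) α W j).symm ▸ hW j

variable (hW : ∀ j, IsUnit (W (l j)))

/-- The extension of `specializeCoord` to `ℂ[x, s, 1/F]`, when the forms go to units. -/
def specialize : PowerModule (fun j => linearFormPoly (l j)) →+* B :=
  IsLocalization.Away.lift (paramProd (fun j => linearFormPoly (l j)))
    (isUnit_specializeCoord_paramProd α hW)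

theorem specialize_algebraMap (q : CoordRing n p) :
    specialize α hW (algebraMap _ _ q) = specializeCoord α W q :=
  IsLocalization.Away.lift_eq _ (isUnit_specializeCoord_paramProd α hW) q

theorem specialize_smul (r : MvPolynomial (Fin p) ℂ)
    (g : PowerModule (fun j => linearFormPoly (l j))) :
    specialize α hW (r • g) = eval α r • specialize α hW g := by
  rw [Algebra.smul_def, IsScalarTower.algebraMap_apply (MvPolynomial (Fin p) ℂ) (CoordRing n p),
    map_mul, specialize_algebraMap, Algebra.smul_def]
  simp [specializeCoord, algebraMap_eq]

theorem specialize_factorMonomial (a : Fin p → ℤ) :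
    specialize α hW (factorMonomial _ a) = ((∏ j, (hW j).unit ^ a j : Bˣ) : B) := by
  have h : ∀ j, Units.map (specialize α hW).toMonoidHom (factorUnit _ j) = (hW j).unit :=
    fun j => Units.ext (by
      simp [coe_factorUnit, specialize_algebraMap, specializeCoord_paramPoly])
  simp only [← h, ← map_zpow, ← map_prod]
  rfl

end Specialize

/-! ### Vanishing on the hyperplanes `s_j = -1` -/

section PoleOrder

variable {n p : ℕ} (l : Fin p → Module.Dual ℂ (Fin n → ℂ))

/-- The functions without pole along `l_j = 0` that vanish there, modulo `s_j + 1`. -/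
def vanishingSubmodule (j : Fin p) : Submodule (MvPolynomial (Fin p) ℂ)
    (PowerModule (fun j => linearFormPoly (l j))) :=
  Submodule.span _ ((fun a => factorMonomial _ a) '' {a : Fin p → ℤ | 1 ≤ a j} ∪
    Set.range fun h => (X j + 1 : MvPolynomial (Fin p) ℂ) • h)

variable {l}

theorem mem_span_of_linearMap {R M : Type} [CommRing R] [AddCommGroup M] [Module R M] {S : Set M}
    (T : M →ₗ[R] M) (h : ∀ g ∈ S, T g ∈ Submodule.span R S) :
    ∀ g ∈ Submodule.span R S, T g ∈ Submodule.span R S :=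
  (Submodule.span_le (p := (Submodule.span R S).comap T)).2 h

theorem factorMonomial_mem_vanishingSubmodule {j : Fin p} {a : Fin p → ℤ} (ha : 1 ≤ a j) :
    factorMonomial _ a ∈ vanishingSubmodule l j :=
  Submodule.subset_span (Or.inl ⟨a, ha, rfl⟩)

theorem smul_mem_vanishingSubmodule (j : Fin p)
    (g : PowerModule (fun j => linearFormPoly (l j))) :
    (X j + 1 : MvPolynomial (Fin p) ℂ) • g ∈ vanishingSubmodule l j :=
  Submodule.subset_span (Or.inr ⟨g, rfl⟩)

theorem xAction_mem_vanishingSubmodule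
    (hspan : ∀ φ : Module.Dual ℂ (Fin n → ℂ), ∃ d : Fin p → ℂ, φ = ∑ k, d k • l k) (j : Fin p)
    (i : Fin n) : ∀ g ∈ vanishingSubmodule l j, xAction _ i g ∈ vanishingSubmodule l j := by
  refine mem_span_of_linearMap _ ?_
  rintro _ (⟨a, ha, rfl⟩ | ⟨g, rfl⟩)
  · obtain ⟨d, hd⟩ := hspan (coordForm n i)
    rw [xAction_linearForm_monomial l hd]
    refine sum_mem fun k _ => Submodule.smul_mem _ _ (factorMonomial_mem_vanishingSubmodule ?_)
    have : (0 : Fin p → ℤ) ≤ Pi.single k 1 := Pi.single_nonneg.2 zero_le_one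
    exact le_add_of_le_of_nonneg ha (this j)
  · rw [map_smul]
    exact smul_mem_vanishingSubmodule j _

/-- The only term of the derivative of a monomial that lowers the exponent of `l_j` to zero has the
coefficient `s_j + 1`. -/
theorem dAction_mem_vanishingSubmodule (j : Fin p) (i : Fin n) :
    ∀ g ∈ vanishingSubmodule l j, dAction _ i g ∈ vanishingSubmodule l j := by
  refine mem_span_of_linearMap _ ?_
  rintro _ (⟨a, ha, rfl⟩ | ⟨g, rfl⟩)
  · rw [dAction_linearForm_monomial]
    refine sum_mem fun k _ => ?_
    by_cases hk : k = j ∧ a j = 1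
    · obtain ⟨rfl, hak⟩ := hk
      rw [hak, Int.cast_one, C_1, mul_smul]
      exact Submodule.smul_mem _ _ (smul_mem_vanishingSubmodule k _)
    · refine Submodule.smul_mem _ _ (factorMonomial_mem_vanishingSubmodule ?_)
      have ha' : 1 ≤ a j := ha
      by_cases hkj : k = j
      · subst hkj
        have : a k ≠ 1 := fun h => hk ⟨rfl, h⟩
        simp; omega
      · simpa [Ne.symm hkj] using ha'
  · rw [map_smul]
    exact smul_mem_vanishingSubmodule j _

/-- A transversal line through a generic point of `l_j = 0`, as a point with power series
coordinates, detects that constants do not vanish along `l_j = 0`. -/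
theorem eval_eq_zero_of_smul_one_mem {j : Fin p} {v w : Fin n → ℂ} (hv : l j v = 0)
    (hw : l j w = 1) (hv' : ∀ k, k ≠ j → l k v ≠ 0) {b : MvPolynomial (Fin p) ℂ}
    (hb : b • (1 : PowerModule (fun j => linearFormPoly (l j))) ∈ vanishingSubmodule l j)
    {α : Fin p → ℂ} (hα : α j = -1) : eval α b = 0 := by
  let K := FractionRing (PowerSeries ℂ)
  let W₀ : Module.Dual ℂ (Fin n → ℂ) →ₗ[ℂ] PowerSeries ℂ :=
    (Module.Dual.eval ℂ (Fin n → ℂ) v).smulRight 1 +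
      (Module.Dual.eval ℂ (Fin n → ℂ) w).smulRight PowerSeries.X
  have hW₀ : ∀ φ, W₀ φ = φ v • (1 : PowerSeries ℂ) + φ w • (PowerSeries.X : PowerSeries ℂ) :=
    fun φ => rfl
  have hj : W₀ (l j) = PowerSeries.X := by rw [hW₀, hv, hw, zero_smul, one_smul, zero_add]
  have hk : ∀ k, k ≠ j → IsUnit (W₀ (l k)) := fun k hkj => by
    rw [PowerSeries.isUnit_iff_constantCoeff, hW₀]
    simpa using hv' k hkj
  let W : Module.Dual ℂ (Fin n → ℂ) →ₗ[ℂ] K :=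
    (IsScalarTower.toAlgHom ℂ (PowerSeries ℂ) K).toLinearMap ∘ₗ W₀
  have hWW : ∀ φ, W φ = algebraMap (PowerSeries ℂ) K (W₀ φ) := fun φ => rfl
  have hinj : Function.Injective (algebraMap (PowerSeries ℂ) K) :=
    IsFractionRing.injective (PowerSeries ℂ) K
  have hW : ∀ k, IsUnit (W (l k)) := fun k => by
    rw [hWW]
    by_cases hkj : k = j
    · subst hkj
      rw [hj, isUnit_iff_ne_zero, Ne, map_eq_zero_iff _ hinj]
      exact PowerSeries.X_ne_zero
    · exact (hk k hkj).map _
  have hS : ∀ g ∈ vanishingSubmodule l j, ∃ P : PowerSeries ℂ,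
      specialize α hW g = algebraMap (PowerSeries ℂ) K (PowerSeries.X * P) := by
    intro g hg
    induction hg using Submodule.span_induction with
    | mem g hg =>
      rcases hg with ⟨a, ha, rfl⟩ | ⟨h, rfl⟩
      · have hz : ∀ k, ∃ U : PowerSeries ℂ, k ≠ j →
            (((hW k).unit ^ a k : Kˣ) : K) = algebraMap (PowerSeries ℂ) K U := fun k => by
          by_cases hkj : k = j
          · exact ⟨0, fun h => (h hkj).elim⟩
          · refine ⟨((hk k hkj).unit ^ a k : (PowerSeries ℂ)ˣ), fun _ => ?_⟩
            have h : (hW k).unit = Units.map (algebraMap (PowerSeries ℂ) K).toMonoidHom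
              (hk k hkj).unit := Units.ext rfl
            rw [h, ← map_zpow]
            rfl
        choose U hU using hz
        have ha' : 1 ≤ a j := ha
        obtain ⟨m, hm⟩ : ∃ m : ℕ, a j = (m : ℤ) + 1 := ⟨(a j - 1).toNat, by omega⟩
        refine ⟨PowerSeries.X ^ m * ∏ k ∈ Finset.univ.erase j, U k, ?_⟩
        change specialize α hW (factorMonomial _ a) = _
        rw [specialize_factorMonomial, ← Finset.mul_prod_erase _ _ (Finset.mem_univ j),
          Units.val_mul, Units.coe_prod, ← mul_assoc, map_mul, map_prod]
        congr 1
        · have h1 : (m : ℤ) + 1 = ((m + 1 : ℕ) : ℤ) := by push_cast; rfl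
          rw [hm, h1, zpow_natCast, Units.val_pow_eq_pow_val, IsUnit.unit_spec, hWW, hj, map_mul,
            map_pow, pow_succ']
        · exact Finset.prod_congr rfl fun k hk => hU k (Finset.ne_of_mem_erase hk)
      · refine ⟨0, ?_⟩
        change specialize α hW ((X j + 1 : MvPolynomial (Fin p) ℂ) • h) = _
        rw [specialize_smul]
        simp [hα]
    | zero => exact ⟨0, by simp⟩
    | add g h _ _ hg hh =>
      obtain ⟨P, hP⟩ := hg
      obtain ⟨Q, hQ⟩ := hh
      exact ⟨P + Q, by rw [map_add, hP, hQ, mul_add, map_add]⟩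
    | smul r g _ hg =>
      obtain ⟨P, hP⟩ := hg
      refine ⟨eval α r • P, ?_⟩
      rw [specialize_smul, hP, mul_smul_comm]
      exact (map_smul (IsScalarTower.toAlgHom ℂ (PowerSeries ℂ) K) _ _).symm
  obtain ⟨P, hP⟩ := hS _ hb
  rw [specialize_smul, map_one, Algebra.smul_def, mul_one,
    IsScalarTower.algebraMap_apply ℂ (PowerSeries ℂ) K] at hP
  have h := congrArg PowerSeries.constantCoeff (hinj hP)
  simpa using h

end PoleOrder

theorem eval_eq_zero_of_mem_bernsteinIdeal_of_eq_neg_one {n : ℕ} (hn : 2 ≤ n)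
    {l : Fin (n + 1) → Module.Dual ℂ (Fin n → ℂ)} (hl : IsGenericFamily l)
    {b : MvPolynomial (Fin (n + 1)) ℂ} (hb : b ∈ bernsteinIdeal (fun j => linearFormPoly (l j)))
    {j : Fin (n + 1)} {α : Fin (n + 1) → ℂ} (hα : α j = -1) : eval α b = 0 := by
  obtain ⟨v, hv, hv'⟩ := hl.exists_generic_point hn j
  have : Nontrivial (Fin (n + 1)) := Fin.nontrivial_iff_two_le.2 (by omega)
  obtain ⟨i, hij⟩ := exists_ne j
  obtain ⟨w, hw⟩ := hl.exists_vector i 1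
  obtain ⟨P, hP⟩ := hb
  refine eval_eq_zero_of_smul_one_mem hv (hw j hij.symm) hv' ?_ hα
  change b • powS _ ∈ _
  rw [hP]
  refine weylAction_mem _ _ (fun i => xAction_mem_vanishingSubmodule hl.exists_eq_sum j i)
    (fun i => dAction_mem_vanishingSubmodule j i) P _ ?_
  rw [powSAddOne_eq_factorMonomial]
  exact factorMonomial_mem_vanishingSubmodule le_rfl

/-! ### Spans of monomials -/

section MonomialSpan

variable {n p : ℕ} {l : Fin p → Module.Dual ℂ (Fin n → ℂ)}

theorem algebraMap_mul_monomial_mem_span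
    (hspan : ∀ φ : Module.Dual ℂ (Fin n → ℂ), ∃ d : Fin p → ℂ, φ = ∑ k, d k • l k)
    (q : CoordRing n p) (m : Fin p → ℤ) :
    algebraMap _ _ q * factorMonomial (fun j => linearFormPoly (l j)) m ∈
      Submodule.span (MvPolynomial (Fin p) ℂ) (factorMonomial (fun j => linearFormPoly (l j)) ''
        {a | ∑ j, m j ≤ ∑ j, a j}) := by
  induction q using MvPolynomial.induction_on generalizing m with
  | C r =>
    have h := Submodule.smul_mem (Submodule.span (MvPolynomial (Fin p) ℂ)
      (factorMonomial (fun j => linearFormPoly (l j)) '' {a | ∑ j, m j ≤ ∑ j, a j})) r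
      (Submodule.subset_span ⟨m, le_refl (∑ j, m j), rfl⟩)
    rwa [← algebraMap_C_mul] at h
  | add q r hq hr =>
    rw [map_add, add_mul]
    exact add_mem (hq m) (hr m)
  | mul_X q i hq =>
    obtain ⟨d, hd⟩ := hspan (coordForm n i)
    rw [map_mul, mul_assoc, ← xAction_apply, xAction_linearForm_monomial l hd, Finset.mul_sum]
    refine sum_mem fun k _ => ?_
    rw [mul_smul_comm]
    refine Submodule.smul_mem _ _ (Submodule.span_mono (Set.image_mono fun a ha => ?_) (hq _))
    have ha' : ∑ j, (m + Pi.single k 1 : Fin p → ℤ) j ≤ ∑ j, a j := ha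
    simp only [Pi.add_apply, Finset.sum_add_distrib, Finset.sum_pi_single', Finset.mem_univ,
      if_true] at ha'
    change ∑ j, m j ≤ ∑ j, a j
    omega

theorem span_factorMonomial_eq_top
    (hspan : ∀ φ : Module.Dual ℂ (Fin n → ℂ), ∃ d : Fin p → ℂ, φ = ∑ k, d k • l k) :
    Submodule.span (MvPolynomial (Fin p) ℂ)
      (Set.range (factorMonomial (fun j => linearFormPoly (l j)))) = ⊤ := by
  refine Submodule.eq_top_iff'.2 fun g => ?_
  obtain ⟨N, q, hq⟩ := IsLocalization.Away.surj (paramProd (fun j => linearFormPoly (l j))) g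
  rw [← map_pow, ← factorMonomial_const] at hq
  have h : g = algebraMap _ _ q * factorMonomial _ (-fun _ => (N : ℤ)) := by
    rw [← hq, mul_assoc, ← factorMonomial_add, add_neg_cancel, factorMonomial_zero, mul_one]
  rw [h]
  exact Submodule.span_mono (Set.image_subset_range _ _)
    (algebraMap_mul_monomial_mem_span hspan q _)

end MonomialSpan

/-! ### Functionals that vanish on derivatives -/

/-- A functional that vanishes on derivatives turns a differential operator into its formal
adjoint, which acts on polynomials. -/
theorem exists_adjoint {n p : ℕ} {f : Fin p → MvPolynomial (Fin n) ℂ} {μ : PowerModule f →+ ℂ}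
    (hμ : ∀ i g, μ (dAction f i g) = 0) (P : WeylAlgebra (MvPolynomial (Fin p) ℂ) n)
    (q : CoordRing n p) :
    ∃ q' : CoordRing n p, ∀ g, μ (algebraMap _ _ q * weylAction f P g) =
      μ (algebraMap _ _ q' * g) := by
  induction P using WeylAlgebra.induction generalizing q with
  | algebraMap r =>
    refine ⟨q * C r, fun g => ?_⟩
    rw [AlgHom.commutes, Module.algebraMap_end_apply, ← algebraMap_C_mul, map_mul (algebraMap _ _),
      mul_assoc]
  | x i =>
    refine ⟨q * X i, fun g => ?_⟩
    rw [weylAction_x, xAction_apply, map_mul (algebraMap _ _), mul_assoc]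
  | d i =>
    refine ⟨-pderiv i q, fun g => ?_⟩
    have h : algebraMap _ _ q * dAction f i g = dAction f i (algebraMap _ _ q * g) +
        algebraMap _ _ (-pderiv i q) * g := by
      simp only [dAction_apply, Derivation.leibniz, smul_eq_mul, map_neg, partialDeriv,
        localizedDerivation_algebraMap]
      ring
    rw [weylAction_d, h, map_add, hμ, zero_add]
  | add P Q hP hQ =>
    obtain ⟨q₁, h₁⟩ := hP q
    obtain ⟨q₂, h₂⟩ := hQ q
    refine ⟨q₁ + q₂, fun g => ?_⟩
    rw [map_add, LinearMap.add_apply, mul_add, map_add, h₁, h₂, map_add, add_mul, map_add]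
  | mul P Q hP hQ =>
    obtain ⟨q₁, h₁⟩ := hP q
    obtain ⟨q₂, h₂⟩ := hQ q₁
    exact ⟨q₂, fun g => by rw [map_mul (weylAction f), Module.End.mul_apply, h₁, h₂]⟩

/-! ### The Gamma functional -/

section GammaFunctional

variable {p : ℕ} (α c : Fin p → ℂ)

/-- The value `∏ Γ(α_j + a_j + 1) c_j^{-a_j}` on the Laurent monomial `y^a` of degree `k`; monomials
of other degrees get the value `0`. -/
def gammaWeight (k : ℤ) (a : Fin p → ℤ) : ℂ :=
  if ∑ j, a j = k then ∏ j, Complex.Gamma (α j + a j + 1) * c j ^ (-a j) else 0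

variable {α c}

theorem gammaWeight_ne_zero (hα : ∀ j, ∀ z : ℤ, α j ≠ z) (hc : ∀ j, c j ≠ 0) {k : ℤ}
    {a : Fin p → ℤ} (ha : ∑ j, a j = k) : gammaWeight α c k a ≠ 0 := by
  rw [gammaWeight, if_pos ha, Finset.prod_ne_zero_iff]
  refine fun j _ => mul_ne_zero (Complex.Gamma_ne_zero fun m hm => ?_) (zpow_ne_zero _ (hc j))
  exact hα j (-m - a j - 1) (by push_cast; linear_combination hm)

/-- The functional equation of the Gamma function in terms of the weights: the factor `c_j` depends
on `j`, but the weight on the right does not. -/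
theorem mul_gammaWeight_sub_single (hα : ∀ j, ∀ z : ℤ, α j ≠ z) (hc : ∀ j, c j ≠ 0) (k : ℤ)
    (a : Fin p → ℤ) (j : Fin p) :
    (α j + a j) * gammaWeight α c k (a - Pi.single j 1) = c j * gammaWeight α c (k + 1) a := by
  have hs : ∑ i, (a - Pi.single j 1 : Fin p → ℤ) i = ∑ i, a i - 1 := by
    simp [Finset.sum_sub_distrib]
  have hcond : (∑ i, a i - 1 = k) ↔ (∑ i, a i = k + 1) := sub_eq_iff_eq_add
  rw [gammaWeight, gammaWeight, hs]
  simp only [hcond]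
  split_ifs with h
  · rw [← Finset.mul_prod_erase _ _ (Finset.mem_univ j),
      ← Finset.mul_prod_erase _ _ (Finset.mem_univ j)]
    have hrest : ∀ i ∈ Finset.univ.erase j,
        Complex.Gamma (α i + ((a - Pi.single j 1 : Fin p → ℤ) i : ℤ) + 1) * c i ^ (-(a - Pi.single j 1 : Fin p → ℤ) i) =
          Complex.Gamma (α i + a i + 1) * c i ^ (-a i) := fun i hi => by
      simp [Finset.ne_of_mem_erase hi]
    rw [Finset.prod_congr rfl hrest]
    have h0 : α j + a j ≠ 0 := fun h => hα j (-a j) (by push_cast; linear_combination h)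
    have hj : (α j + ((a - Pi.single j 1 : Fin p → ℤ) j : ℤ) + 1 : ℂ) = α j + a j := by
      rw [Pi.sub_apply, Pi.single_eq_same]
      push_cast
      ring
    have hcj : c j ^ (-(a - Pi.single j 1 : Fin p → ℤ) j) = c j * c j ^ (-a j) := by
      rw [← zpow_one_add₀ (hc j)]
      congr 1
      simp; ring
    rw [hj, hcj, Complex.Gamma_add_one _ h0]
    ring
  · simp

/-- The weights respect the relation `∑ c_j y_j = 0`, because on the hyperplane in question the sum
of the `α_j + a_j + 1` is zero for the only degree of `a` that matters. -/
theorem sum_mul_gammaWeight_add_single (hα : ∀ j, ∀ z : ℤ, α j ≠ z) (hc : ∀ j, c j ≠ 0) {k : ℤ}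
    (hk : ∑ j, α j = -(p - 1 + k)) (a : Fin p → ℤ) :
    ∑ j, c j * gammaWeight α c k (a + Pi.single j 1) = 0 := by
  have h : ∀ j, c j * gammaWeight α c k (a + Pi.single j 1) =
      (α j + a j + 1) * gammaWeight α c (k - 1) a := fun j => by
    have h := mul_gammaWeight_sub_single hα hc (k - 1) (a + Pi.single j 1) j
    rw [add_sub_cancel_right, sub_add_cancel] at h
    rw [← h]
    simp [add_assoc]
  simp only [h]
  rw [← Finset.sum_mul]
  by_cases hs : ∑ j, a j = k - 1
  · have hs' : ∑ j, (a j : ℂ) = k - 1 := by exact_mod_cast hs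
    have h0 : ∑ j, (α j + a j + 1) = 0 := by
      rw [Finset.sum_add_distrib, Finset.sum_add_distrib, hk, hs']
      simp
      ring
    rw [h0, zero_mul]
  · rw [gammaWeight, if_neg hs, mul_zero]

variable (c) in
/-- The element `∑ c_j y_j` of the ring of Laurent polynomials in the `y_j`. -/
def laurentRelation : AddMonoidAlgebra ℂ (Fin p → ℤ) :=
  ∑ j, AddMonoidAlgebra.single (Pi.single j 1) (c j)

variable (c) in
/-- The ring `ℂ[y₁^{±1}, …, y_p^{±1}] / (∑ c_j y_j)`. -/
abbrev LaurentQuotient : Type :=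
  AddMonoidAlgebra ℂ (Fin p → ℤ) ⧸ Ideal.span {laurentRelation c}

variable (α c) in
/-- The functional on Laurent polynomials with the values `gammaWeight` on the monomials. -/
def gammaFunctional (k : ℤ) : AddMonoidAlgebra ℂ (Fin p → ℤ) →ₗ[ℂ] ℂ :=
  Finsupp.linearCombination ℂ (gammaWeight α c k) ∘ₗ
    (AddMonoidAlgebra.coeffLinearEquiv ℂ).toLinearMap

theorem gammaFunctional_single (k : ℤ) (a : Fin p → ℤ) (r : ℂ) :
    gammaFunctional α c k (AddMonoidAlgebra.single a r) = r * gammaWeight α c k a := by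
  change Finsupp.linearCombination ℂ (gammaWeight α c k) (Finsupp.single a r) = _
  rw [Finsupp.linearCombination_single, smul_eq_mul]

theorem gammaFunctional_eq_zero_of_mem (hα : ∀ j, ∀ z : ℤ, α j ≠ z) (hc : ∀ j, c j ≠ 0) {k : ℤ}
    (hk : ∑ j, α j = -(p - 1 + k)) {t : AddMonoidAlgebra ℂ (Fin p → ℤ)}
    (ht : t ∈ Ideal.span {laurentRelation c}) : gammaFunctional α c k t = 0 := by
  obtain ⟨u, rfl⟩ := Ideal.mem_span_singleton'.1 ht
  induction u using AddMonoidAlgebra.induction_on with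
  | of a =>
    have h : AddMonoidAlgebra.of ℂ (Fin p → ℤ) (Multiplicative.ofAdd a) * laurentRelation c =
        ∑ j, AddMonoidAlgebra.single (a + Pi.single j 1) (c j) := by
      rw [laurentRelation, Finset.mul_sum]
      refine Finset.sum_congr rfl fun j _ => ?_
      rw [AddMonoidAlgebra.of_apply, AddMonoidAlgebra.single_mul_single, one_mul]
      rfl
    rw [h, map_sum]
    simp only [gammaFunctional_single]
    exact sum_mul_gammaWeight_add_single hα hc hk a
  | add u v hu hv =>
    rw [add_mul, map_add, hu (Ideal.mul_mem_left _ _ (Ideal.mem_span_singleton_self _)),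
      hv (Ideal.mul_mem_left _ _ (Ideal.mem_span_singleton_self _)), add_zero]
  | smul r u hu =>
    rw [smul_mul_assoc, map_smul, hu (Ideal.mul_mem_left _ _ (Ideal.mem_span_singleton_self _)),
      smul_zero]

/-- The Gamma functional descends to the quotient by `∑ c_j y_j`. -/
theorem exists_functional_laurentQuotient (hα : ∀ j, ∀ z : ℤ, α j ≠ z) (hc : ∀ j, c j ≠ 0) {k : ℤ}
    (hk : ∑ j, α j = -(p - 1 + k)) :
    ∃ Λ : LaurentQuotient c →ₗ[ℂ] ℂ, ∀ a : Fin p → ℤ,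
      Λ (Ideal.Quotient.mk _ (AddMonoidAlgebra.single a 1)) = gammaWeight α c k a := by
  let I : Ideal (AddMonoidAlgebra ℂ (Fin p → ℤ)) := Ideal.span {laurentRelation c}
  refine ⟨(Submodule.liftQ (I.restrictScalars ℂ) (gammaFunctional α c k) fun t ht =>
    gammaFunctional_eq_zero_of_mem hα hc hk ht) ∘ₗ
      (Submodule.Quotient.restrictScalarsEquiv ℂ I).symm.toLinearMap, fun a => ?_⟩
  change gammaFunctional α c k (AddMonoidAlgebra.single a 1) = _
  rw [gammaFunctional_single, one_mul]

theorem mk_single_eq_prod (u : Fin p → (LaurentQuotient c)ˣ)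
    (hu : ∀ j, (u j : LaurentQuotient c) =
      Ideal.Quotient.mk _ (AddMonoidAlgebra.single (Pi.single j 1) 1)) (a : Fin p → ℤ) :
    ((∏ j, u j ^ a j : (LaurentQuotient c)ˣ) : LaurentQuotient c) =
      Ideal.Quotient.mk _ (AddMonoidAlgebra.single a 1) := by
  let H : Multiplicative (Fin p → ℤ) →* (LaurentQuotient c)ˣ := MonoidHom.toHomUnits
    ((Ideal.Quotient.mk (Ideal.span {laurentRelation c})).toMonoidHom.comp
      (AddMonoidAlgebra.of ℂ (Fin p → ℤ)))
  have hH : ∀ j, H (Multiplicative.ofAdd (Pi.single j 1)) = u j := fun j =>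
    Units.ext (hu j).symm
  have ha : Multiplicative.ofAdd a = ∏ j, Multiplicative.ofAdd (Pi.single j (1 : ℤ)) ^ a j := by
    simp only [← ofAdd_zsmul, ← ofAdd_sum]
    congr 1
    conv_lhs => rw [← Finset.univ_sum_single a]
    refine Finset.sum_congr rfl fun j _ => ?_
    rw [← Pi.single_smul, smul_eq_mul, mul_one]
  have h : H (Multiplicative.ofAdd a) = ∏ j, u j ^ a j := by
    rw [ha, map_prod]
    exact Finset.prod_congr rfl fun j _ => by rw [map_zpow, hH]
  rw [← h]
  rfl

end GammaFunctional

/-! ### Vanishing on the hyperplanes `s₁ + ⋯ + s_{n+1} = -n - k` -/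

section Hyperplane

variable {n : ℕ} {l : Fin (n + 1) → Module.Dual ℂ (Fin n → ℂ)}

/-- On the Laurent monomials in the forms the Gamma functional takes the values of twisted
integrals of `l^α` over a projective simplex. -/
theorem exists_functional_powerModule (hl : IsGenericFamily l) {c : Fin (n + 1) → ℂ}
    (hc : ∀ j, c j ≠ 0) (hcl : ∑ j, c j • l j = 0) {α : Fin (n + 1) → ℂ}
    (hα : ∀ j, ∀ z : ℤ, α j ≠ z) {k : ℤ} (hk : ∑ j, α j = -(n + k)) :
    ∃ μ : PowerModule (fun j => linearFormPoly (l j)) →+ ℂ,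
      (∀ r g, μ (r • g) = eval α r * μ g) ∧
      ∀ a, μ (factorMonomial _ a) = gammaWeight α c k a := by
  obtain ⟨Λ, hΛ⟩ := exists_functional_laurentQuotient (k := k) hα hc (by rw [hk]; push_cast; ring)
  let Y : Fin (n + 1) → LaurentQuotient c := fun j =>
    Ideal.Quotient.mk _ (AddMonoidAlgebra.single (Pi.single j 1) 1)
  have hY : ∑ j, c j • Y j = 0 := by
    have h : ∑ j, c j • Y j = Ideal.Quotient.mk (Ideal.span {laurentRelation c})
        (∑ j, AddMonoidAlgebra.single (Pi.single j 1) (c j)) := by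
      rw [map_sum]
      refine Finset.sum_congr rfl fun j _ => ?_
      change Ideal.Quotient.mk _ (c j • AddMonoidAlgebra.single (Pi.single j 1) 1) = _
      rw [AddMonoidAlgebra.smul_single, smul_eq_mul, mul_one]
    rw [h, Ideal.Quotient.eq_zero_iff_mem]
    exact Ideal.mem_span_singleton_self _
  obtain ⟨W, hW⟩ := hl.exists_linearMap_of_relation hc hcl Y hY
  have hu : ∀ j, IsUnit (W (l j)) := fun j => by
    rw [hW]
    refine IsUnit.map _ (IsUnit.of_mul_eq_one
      (AddMonoidAlgebra.single (-Pi.single j 1) 1) ?_)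
    rw [AddMonoidAlgebra.single_mul_single, add_neg_cancel, one_mul]
    rfl
  refine ⟨Λ.toAddMonoidHom.comp (specialize α hu).toAddMonoidHom, fun r g => ?_, fun a => ?_⟩
  · change Λ (specialize α hu (r • g)) = _ * Λ (specialize α hu g)
    rw [specialize_smul, map_smul, smul_eq_mul]
  · change Λ (specialize α hu (factorMonomial _ a)) = _
    rw [specialize_factorMonomial, mk_single_eq_prod _ (fun j => hW j), hΛ]

/-- If `b l^s = P F l^s` and `μ` is the Gamma functional, then `b(α) μ(l₁^k)` equals
`μ(q' F)` for a polynomial `q'`, and this is zero for reasons of degree. -/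
theorem eval_eq_zero_of_mem_bernsteinIdeal_of_sum_eq (hl : IsGenericFamily l)
    {b : MvPolynomial (Fin (n + 1)) ℂ} (hb : b ∈ bernsteinIdeal (fun j => linearFormPoly (l j)))
    {k : ℕ} (hk : k ≤ n) {α : Fin (n + 1) → ℂ} (hα : ∀ j, ∀ z : ℤ, α j ≠ z)
    (hs : ∑ j, α j = -((n : ℂ) + k)) : eval α b = 0 := by
  obtain ⟨c, hc, hcl⟩ := hl.exists_relation
  obtain ⟨μ, hsmul, hμ⟩ := exists_functional_powerModule hl hc hcl hα (k := k)
    (by rw [hs, Int.cast_natCast])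
  have hd : ∀ i g, μ (dAction _ i g) = 0 := fun i g => by
    have hg : g ∈ Submodule.span (MvPolynomial (Fin (n + 1)) ℂ)
        (Set.range (factorMonomial (fun j => linearFormPoly (l j)))) :=
      span_factorMonomial_eq_top hl.exists_eq_sum ▸ Submodule.mem_top
    induction hg using Submodule.span_induction with
    | mem g hg =>
      obtain ⟨a, rfl⟩ := hg
      have h : ∀ j, (l j (Pi.single i 1) * (α j + a j)) *
          gammaWeight α c k (a - Pi.single j 1) =
            (c j * l j (Pi.single i 1)) * gammaWeight α c (k + 1) a := fun j => by
        linear_combination l j (Pi.single i 1) * mul_gammaWeight_sub_single hα hc k a j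
      rw [dAction_linearForm_monomial, map_sum]
      simp only [hsmul, hμ, map_mul, map_add, eval_X, eval_C, h]
      rw [← Finset.sum_mul]
      have h0 := congrArg (fun φ : Module.Dual ℂ (Fin n → ℂ) => φ (Pi.single i 1)) hcl
      simp only [LinearMap.sum_apply, LinearMap.smul_apply, smul_eq_mul,
        LinearMap.zero_apply] at h0
      rw [h0, zero_mul]
    | zero => rw [map_zero, map_zero]
    | add g h _ _ hg hh => rw [map_add, map_add, hg, hh, add_zero]
    | smul r g _ hg => rw [map_smul, hsmul, hg, mul_zero]
  obtain ⟨P, hP⟩ := hb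
  obtain ⟨q', hq'⟩ := exists_adjoint hd P (paramPoly (fun j => linearFormPoly (l j)) 0 ^ k)
  have h1 := hq' (powSAddOne _)
  rw [← hP, powSAddOne_eq_factorMonomial, mul_smul_comm, hsmul] at h1
  have h2 : algebraMap _ _ (paramPoly (fun j => linearFormPoly (l j)) 0 ^ k) * powS _ =
      factorMonomial (fun j => linearFormPoly (l j)) (Pi.single 0 (k : ℤ)) := by
    rw [factorMonomial_single]
    exact mul_one _
  have h3 : μ (algebraMap _ _ q' * factorMonomial (fun j => linearFormPoly (l j)) 1) = 0 := by
    have h := algebraMap_mul_monomial_mem_span hl.exists_eq_sum q' (1 : Fin (n + 1) → ℤ)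
    generalize algebraMap _ _ q' * factorMonomial (fun j => linearFormPoly (l j)) 1 = g at h
    induction h using Submodule.span_induction with
    | mem g hg =>
      obtain ⟨a, ha, rfl⟩ := hg
      have ha' : ∑ j, (1 : Fin (n + 1) → ℤ) j ≤ ∑ j, a j := ha
      simp at ha'
      rw [hμ, gammaWeight, if_neg (by omega)]
    | zero => exact map_zero μ
    | add g h _ _ hg hh => rw [map_add, hg, hh, add_zero]
    | smul r g _ hg => rw [hsmul, hg, mul_zero]
  rw [h2, h3, hμ] at h1
  exact (mul_eq_zero.1 h1).resolve_right (gammaWeight_ne_zero hα hc (by simp))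

end Hyperplane

/-! ### Divisibility by linear factors -/

section LinearFactors

variable {p : ℕ}

/-- The substitution `X_j ↦ X_j - h`. If `h` is `X_j` plus a polynomial in the other variables, it
eliminates `X_j` by means of the equation `h = 0`. -/
def eliminate (j : Fin p) (h : MvPolynomial (Fin p) ℂ) :
    MvPolynomial (Fin p) ℂ →ₐ[ℂ] MvPolynomial (Fin p) ℂ :=
  aeval (Function.update X j (X j - h))

theorem dvd_sub_eliminate (j : Fin p) (h b : MvPolynomial (Fin p) ℂ) :
    h ∣ b - eliminate j h b := by
  rw [← Ideal.mem_span_singleton, ← Ideal.Quotient.eq]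
  have : (Ideal.Quotient.mkₐ ℂ (Ideal.span {h})) =
      (Ideal.Quotient.mkₐ ℂ (Ideal.span {h})).comp (eliminate j h) := by
    refine MvPolynomial.algHom_ext fun i => ?_
    by_cases hi : i = j
    · subst hi
      have h0 : Ideal.Quotient.mkₐ ℂ (Ideal.span {h}) h = 0 :=
        Ideal.Quotient.eq_zero_iff_mem.2 (Ideal.mem_span_singleton_self h)
      rw [AlgHom.comp_apply, eliminate, aeval_X, Function.update_self, map_sub, h0, sub_zero]
    · simp [eliminate, hi]
  exact congrArg (fun φ : _ →ₐ[ℂ] _ => φ b) this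

/-- The hypothesis holds if `h` is `X_j` plus a polynomial in the other variables. -/
theorem dvd_iff_eliminate_eq_zero {j : Fin p} {h : MvPolynomial (Fin p) ℂ}
    (hh : eliminate j h h = 0) (b : MvPolynomial (Fin p) ℂ) :
    h ∣ b ↔ eliminate j h b = 0 := by
  constructor
  · rintro ⟨c, rfl⟩
    rw [map_mul, hh, zero_mul]
  · intro hb
    simpa [hb] using dvd_sub_eliminate j h b

theorem prime_of_eliminate_eq_zero {j : Fin p} {h : MvPolynomial (Fin p) ℂ}
    (hh : eliminate j h h = 0) (h0 : h ≠ 0) : Prime h := by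
  refine ⟨h0, fun hu => ?_, fun a b hab => ?_⟩
  · have h1 := (dvd_iff_eliminate_eq_zero hh 1).1 hu.dvd
    rw [map_one] at h1
    exact one_ne_zero h1
  · rw [dvd_iff_eliminate_eq_zero hh, map_mul, mul_eq_zero] at hab
    simpa only [dvd_iff_eliminate_eq_zero hh] using hab

theorem eval_eliminate (j : Fin p) (h b : MvPolynomial (Fin p) ℂ) (β : Fin p → ℂ) :
    eval β (eliminate j h b) = eval (Function.update β j (β j - eval β h)) b := by
  have : (eval β).comp (eliminate j h).toRingHom =
      eval (Function.update β j (β j - eval β h)) := by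
    refine MvPolynomial.ringHom_ext (fun r => by simp [eliminate]) fun i => ?_
    by_cases hi : i = j
    · subst hi
      simp [eliminate]
    · simp [eliminate, hi]
  exact congrArg (fun φ : _ →+* ℂ => φ b) this

theorem eliminate_X_add_one (j : Fin p) : eliminate j (X j + 1) (X j + 1) = 0 := by
  simp [eliminate]

theorem eliminate_sum_X_add_C (j : Fin p) (c : ℂ) :
    eliminate j ((∑ i, X i) + C c) ((∑ i, X i) + C c) = 0 := by
  have h : eliminate j ((∑ i, X i) + C c) (∑ i, X i) = -C c := by
    rw [map_sum, ← Finset.add_sum_erase _ _ (Finset.mem_univ j)]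
    have h2 : ∑ i ∈ Finset.univ.erase j, eliminate j ((∑ i, X i) + C c) (X i) =
        ∑ i ∈ Finset.univ.erase j, X i := Finset.sum_congr rfl fun i hi => by
      simp [eliminate, Finset.ne_of_mem_erase hi]
    rw [h2]
    simp only [eliminate, aeval_X, Function.update_self]
    rw [← Finset.add_sum_erase _ _ (Finset.mem_univ j)]
    ring
  rw [map_add, h, eliminate, aeval_C, algebraMap_eq, neg_add_cancel]

theorem X_add_one_dvd (j : Fin p) {b : MvPolynomial (Fin p) ℂ}
    (hb : ∀ α : Fin p → ℂ, α j = -1 → eval α b = 0) : X j + 1 ∣ b := by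
  rw [dvd_iff_eliminate_eq_zero (eliminate_X_add_one j)]
  refine MvPolynomial.funext fun β => ?_
  rw [eval_eliminate, map_zero]
  exact hb _ (by simp)

/-- It suffices to test points without integral coordinates. -/
theorem sum_X_add_C_dvd {m : ℕ} (hm : 1 ≤ m) (c : ℝ) {b : MvPolynomial (Fin (m + 1)) ℂ}
    (hb : ∀ α : Fin (m + 1) → ℂ, (∀ j, ∀ z : ℤ, α j ≠ z) → ∑ j, α j = -c → eval α b = 0) :
    (∑ j, X j) + C (c : ℂ) ∣ b := by
  rw [dvd_iff_eliminate_eq_zero (eliminate_sum_X_add_C 0 (c : ℂ))]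
  -- test points have imaginary part `1` in all coordinates but the eliminated one, where it is `-m`
  refine MvPolynomial.funext_set (fun _ => Set.range fun t : ℝ => (t + Complex.I : ℂ))
    (fun _ => Set.infinite_range_of_injective fun t u htu => by simpa using htu) fun β hβ => ?_
  have him : ∀ j, (β j).im = 1 := fun j => by
    obtain ⟨t, ht⟩ := hβ j (Set.mem_univ j)
    rw [← ht]; simp
  rw [eval_eliminate, map_zero]
  have hval : β 0 - eval β ((∑ j, X j) + C (c : ℂ)) = -c - ∑ j : Fin m, β j.succ := by
    simp [Fin.sum_univ_succ]; ring
  refine hb _ (fun j z hz => ?_) ?_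
  · have hz' := congrArg Complex.im hz
    by_cases hj : j = 0
    · subst hj
      rw [Function.update_self, hval] at hz'
      simp [him] at hz'
      omega
    · rw [Function.update_of_ne hj, him] at hz'
      simp at hz'
  · rw [Fin.sum_univ_succ, Function.update_self, hval]
    simp [Fin.succ_ne_zero]

theorem isRelPrime_of_eval {h g : MvPolynomial (Fin p) ℂ} (hh : Prime h) (α : Fin p → ℂ)
    (h0 : eval α h = 0) (hg : eval α g ≠ 0) : IsRelPrime h g := by
  rw [hh.irreducible.isRelPrime_iff_not_dvd]
  rintro ⟨q, rfl⟩
  exact hg (by rw [map_mul, h0, zero_mul])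

/-- The linear factors are primes, and each pair is separated by a point on one of the hyperplanes,
so they divide `b` jointly if they do so separately. -/
theorem prod_linear_factors_dvd {n : ℕ} (hn : 2 ≤ n) {b : MvPolynomial (Fin (n + 1)) ℂ}
    (h1 : ∀ j, X j + 1 ∣ b) (h2 : ∀ k ≤ n, (∑ j, X j) + C ((n : ℂ) + (k : ℂ)) ∣ b) :
    (∏ j, (X j + 1)) * ∏ k ∈ Finset.range (n + 1), ((∑ j, X j) + C ((n : ℂ) + (k : ℂ))) ∣ b := by
  have hp1 : ∀ j : Fin (n + 1), Prime (X j + 1 : MvPolynomial (Fin (n + 1)) ℂ) := fun j =>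
    prime_of_eliminate_eq_zero (eliminate_X_add_one j) fun h => by
      simpa using congrArg (eval (0 : Fin (n + 1) → ℂ)) h
  have hp2 : ∀ c : ℂ, Prime ((∑ j, X j) + C c : MvPolynomial (Fin (n + 1)) ℂ) := fun c =>
    prime_of_eliminate_eq_zero (eliminate_sum_X_add_C 0 c) fun h => by
      simpa using congrArg (eval (Pi.single 0 (1 - c) : Fin (n + 1) → ℂ)) h
  refine IsRelPrime.mul_dvd ?_ (Finset.prod_dvd_of_isRelPrime ?_ fun j _ => h1 j)
    (Finset.prod_dvd_of_isRelPrime ?_ fun k hk => h2 k (by simpa [Nat.lt_succ_iff] using hk))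
  · refine IsRelPrime.prod_left fun j _ => IsRelPrime.prod_right fun k _ => ?_
    refine isRelPrime_of_eval (hp1 j) (Pi.single j (-1)) (by simp) ?_
    have h : (-1 + (n + k) : ℂ) = ((n + k - 1 : ℤ) : ℂ) := by push_cast; ring
    simp only [map_add, map_sum, eval_X, eval_C]
    rw [Finset.sum_pi_single', if_pos (Finset.mem_univ _), h, Int.cast_ne_zero]
    omega
  · intro i _ j _ hij
    exact isRelPrime_of_eval (hp1 i) (Pi.single i (-1)) (by simp) (by simp [hij.symm])
  · intro i _ j _ hij
    refine isRelPrime_of_eval (hp2 _) (Pi.single 0 (-((n : ℂ) + i))) (by simp) ?_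
    have h : (-((n : ℂ) + i) + (n + j)) = ((j - i : ℤ) : ℂ) := by push_cast; ring
    simp only [map_add, map_sum, eval_X, eval_C]
    rw [Finset.sum_pi_single', if_pos (Finset.mem_univ _), h, Int.cast_ne_zero]
    omega

end LinearFactors

end

/-! ### The Bernstein ideal of a generic family of `n + 1` linear forms -/

theorem mainTheorem1 (n : ℕ) (hn : 2 ≤ n) (l : Fin (n + 1) → Module.Dual ℂ (Fin n → ℂ))
    (hl : IsGenericFamily l) :
    bernsteinIdeal (fun j => linearFormPoly (l j)) =
      Ideal.span {(∏ j : Fin (n + 1), (MvPolynomial.X j + 1)) *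
        ∏ k ∈ Finset.range (n + 1),
          ((∑ j : Fin (n + 1), MvPolynomial.X j) + MvPolynomial.C ((n : ℂ) + (k : ℂ)))} := by
  refine le_antisymm (fun b hb => ?_) ?_
  · rw [Ideal.mem_span_singleton]
    refine prod_linear_factors_dvd hn (fun j => X_add_one_dvd j fun α hα =>
      eval_eq_zero_of_mem_bernsteinIdeal_of_eq_neg_one hn hl hb hα) fun k hk => ?_
    have h := sum_X_add_C_dvd (m := n) (by omega) ((n : ℝ) + k) (b := b) fun α hα hs =>
      eval_eq_zero_of_mem_bernsteinIdeal_of_sum_eq hl hb hk hα (by rw [hs]; push_cast; ring)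
    simpa using h
  · rw [Ideal.span_le, Set.singleton_subset_iff]
    exact prod_mem_bernsteinIdeal hl
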